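/- Let $\mathbb F$ be a field with algebraic closure $\overline{\mathbb F}$ and $V$ an $\mathbb F$-vector space of finite positive dimension. A tridiagonal pair on $V$ is a pair of diagonalizable linear maps $A,A^*:V\to V$ whose eigenspaces admit orderings $\{V_i\}_{i=0}^d$ (for $A$) and $\{V_i^*\}_{i=0}^\delta$ (for $A^*$) with $A^*V_i\subseteq V_{i-1}+V_i+V_{i+1}$ and $AV^*_i\subseteq V^*_{i-1}+V^*_i+V^*_{i+1}$ (standard orderings), and such that no subspace other than $0,V$ is invariant under both maps. A tridiagonal system $\Phi=(A;\{E_i\}_{i=0}^d;A^*;\{E_i^*\}_{i=0}^d)$ is such a pair together with standard orderings of the primitive idempotents; it is sharp if $\dim E_0V=1$. Let $\theta_i,\theta_i^*$ be the eigenvalues of $A,A^*$ on $E_iV,E_i^*V$. The group $D_4=\langle *,\downarrow,\Downarrow\rangle$ (with relations $*^2=\downarrow^2=\Downarrow^2=1$, $\Downarrow *=*\downarrow$, $\downarrow *=*\Downarrow$, $\downarrow\Downarrow=\Downarrow\downarrow$) acts on tridiagonal systems: $*$ exchanges $(A;\{E_i\})$ and $(A^*;\{E_i^*\})$, $\downarrow$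 replaces $E^*_i$ by $E^*_{d-i}$, and $\Downarrow$ replaces $E_i$ by $E_{d-i}$. Let $\Phi$ be sharp. For $0\le i\le d$ the map $(A^*-\theta_1^*)\cdots(A^*-\theta_i^*)(A-\theta_{i-1})\cdots(A-\theta_0)$ acts on the line $E_0^*V$ as a scalar $\zeta_i$. A base $\beta\in\mathbb F$ of $\Phi$ is, for $d\ge 3$, the scalar such that $\beta+1$ is the common value of $\frac{\theta_{i-2}-\theta_{i+1}}{\theta_{i-1}-\theta_i}$ and $\frac{\theta^*_{i-2}-\theta^*_{i+1}}{\theta^*_{i-1}-\theta^*_i}$ for $2\le i\le d-1$ (such a scalar exists); for $d\le 2$ it is any nonzero scalar, the same one being used for all relatives of $\Phi$ under $D_4$. The type is I if $\beta\ne\pm2$; II if $\beta=2$, $\operatorname{char}\mathbb F\neq2$; III$^+$ (III$^-$) if $\beta=-2$, $\operatorname{char}\mathbb F\ne2$ and $d$ is even (odd); IV if $\beta=0$, $\operatorname{char}\mathbb F=2$. Then there are scalars $a,b,c,a^*,b^*,c^*$ (in $\overline{\mathbb F}$ for type I, with a fixed $q\in\overline{\mathbb F}$, $q\neq0$, $q^2+q^{-2}=\beta$;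 in $\mathbb F$ otherwise) such that for $0\le i\le d$ * I: $\theta_i=a+bq^{2i-d}+cq^{d-2i}$; * II: $\theta_i=a+b(i-d/2)+ci(d-i)$; * III: $\theta_i=a+b+c(i-d/2)$ for $i$ even, $\theta_i=a-b-c(i-d/2)$ for $i$ odd; * IV: $d=3$ and $\theta_0=a$, $\theta_1=b+c$, $\theta_2=a+c$, $\theta_3=b$; and likewise for $\theta_i^*$ with $a^*,b^*,c^*$. The Drinfel'd polynomial is $P=\sum_{i=0}^d\zeta_i\,p_{i+1}\cdots p_d$ for types other than III$^+$, where $p_i=(\theta_0\theta_d^*+\theta_d\theta_0^*-\lambda)\alpha_i+(\theta_0-\theta_i)(\theta_0^*-\theta_i^*)$ with $\alpha_i=\frac{(q^i-q^{-i})^2}{(q^d-q^{-d})^2}$ (I), $\alpha_i=i^2/d^2$ (II), and $\alpha_i=0$ for $i$ even, $\alpha_i=1$ for $i$ odd (III$^-$, IV). For type III$^+$, $P=p_1\cdots p_d$ with $p_i=(\theta_0\theta_d^*+\theta_d\theta_0^*-\lambda)i^2/d^2+(\theta_0-\theta_i)(\theta_0^*-\theta_i^*)$ for $i$ even and $p_i=\theta_0\theta_d^*+\theta_d\theta_0^*-\lambda$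 for $i$ odd. The normalized Drinfel'd polynomial is $\hat P=P$ for type III$^+$ and $\hat P=\sum_{i=0}^d\zeta_i\,\hat p_{i+1}\cdots\hat p_d$ otherwise, where * I: $\hat p_i=(q^i-q^{-i})^2(bb^*q^{2i-2d}+cc^*q^{2d-2i}-\lambda)$; * II: $\hat p_i=i^2(bb^*/2+(bc^*+cb^*)(d-i)+cc^*(d-i)^2-\lambda)$; * III$^-$: $\hat p_i=cc^*i^2$ for $i$ even, $\hat p_i=2bb^*+2(bc^*+cb^*)(i-d)+cc^*(i-d)^2-\lambda$ for $i$ odd; * IV: $\hat p_1=ab^*+ba^*+(a+b+c)(a^*+b^*+c^*)+\lambda$, $\hat p_2=cc^*$, $\hat p_3=ab^*+ba^*+(a+b)(a^*+b^*)+\lambda$. Theorem. For every sharp tridiagonal system $\Phi$, the objects above exist; $\hat P(\lambda)=P(u\lambda+v)$, where $u=(q^d-q^{-d})^2$, $v=2aa^*+2(b+c)(b^*+c^*)+(q^d+q^{-d})(a(b^*+c^*)+a^*(b+c))$ for type I; $u=d^2$, $v=2aa^*$ for type II; $u=1$, $v=(2a-cd)(2a^*-c^*d)/2$ for type III$^-$;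 $u=1$, $v=0$ for types III$^+$ and IV; and $\hat P$ is $D_4$-invariant: for every $g\in D_4$, the normalized Drinfel'd polynomials of $\Phi$ and of its relative under $g$ coincide, whatever scalars $q,a,b,c,a^*,b^*,c^*$ are used for each of the two systems, except that for type I with $d=1$ (where these scalars are not unique) the scalars of the relative are those obtained from the scalars of $\Phi$ by the corresponding action of $D_4$ with $q$ fixed: $*$ exchanges $(a,b,c)$ and $(a^*,b^*,c^*)$, $\downarrow$ exchanges $b^*$ and $c^*$, and $\Downarrow$ exchanges $b$ and $c$. (For type I, these transported scalars are always valid scalars for the relative.) -/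

import Mathlib

open Polynomial

/-! ### Tridiagonal pairs -/

section Pairs

variable {F V : Type*} [Field F] [AddCommGroup V] [Module F V]

/-- `A` is diagonalizable: `V` is spanned by the eigenspaces of `A`. -/
def IsDiagonalizableEnd (A : Module.End F V) : Prop :=
  ⨆ θ : F, A.eigenspace θ = ⊤

/-- `W 0, …, W d` is an ordering of the (nonzero) eigenspaces of `A`. -/
def IsEigenspaceOrdering (A : Module.End F V) {d : ℕ} (W : Fin (d + 1) → Submodule F V) : Prop :=
  Function.Injective W ∧ Set.range W = {U | U ≠ ⊥ ∧ ∃ θ : F, U = A.eigenspace θ}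

/-- `W 0, …, W d` is a standard ordering of the eigenspaces of `A` (relative to `B`):
`B (W i) ⊆ W (i-1) + W i + W (i+1)`, where `W (-1) = W (d+1) = 0`. -/
def IsStandardOrdering (A B : Module.End F V) {d : ℕ} (W : Fin (d + 1) → Submodule F V) : Prop :=
  IsEigenspaceOrdering A W ∧
    ∀ i, (W i).map B ≤ ⨆ j : Fin (d + 1), ⨆ _ : (j : ℕ) ≤ i + 1 ∧ (i : ℕ) ≤ j + 1, W j

/-- The pair `A, As` is a tridiagonal pair on `V`. -/
structure IsTridiagonalPair (A As : Module.End F V) : Prop where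
  diag : IsDiagonalizableEnd A
  diag_dual : IsDiagonalizableEnd As
  standard : ∃ (d : ℕ) (W : Fin (d + 1) → Submodule F V), IsStandardOrdering A As W
  standard_dual : ∃ (d : ℕ) (W : Fin (d + 1) → Submodule F V), IsStandardOrdering As A W
  irreducible : ¬ ∃ W : Submodule F V, W.map A ≤ W ∧ W.map As ≤ W ∧ W ≠ ⊥ ∧ W ≠ ⊤

/-- `E 0, …, E d` is a standard ordering of the primitive idempotents of `A` (relative to `B`):
for a standard ordering `W` of the eigenspaces of `A`, each `E i` is the identity on `W i` and
zero on `W j` for `j ≠ i`. -/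
def IsStandardIdempotents (A B : Module.End F V) {d : ℕ} (E : Fin (d + 1) → Module.End F V) :
    Prop :=
  ∃ W : Fin (d + 1) → Submodule F V, IsStandardOrdering A B W ∧
    ∀ i, (∀ v ∈ W i, E i v = v) ∧ ∀ j, j ≠ i → ∀ v ∈ W j, E i v = 0

theorem IsTridiagonalPair.swap {A As : Module.End F V} (h : IsTridiagonalPair A As) :
    IsTridiagonalPair As A :=
  ⟨h.diag_dual, h.diag, h.standard_dual, h.standard,
    fun ⟨W, h1, h2, h3⟩ => h.irreducible ⟨W, h2, h1, h3⟩⟩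

theorem IsStandardOrdering.rev {A B : Module.End F V} {d : ℕ} {W : Fin (d + 1) → Submodule F V}
    (h : IsStandardOrdering A B W) : IsStandardOrdering A B (fun i => W i.rev) := by
  obtain ⟨⟨hinj, hrange⟩, hmap⟩ := h
  refine ⟨⟨hinj.comp Fin.rev_injective, ?_⟩, fun i => (hmap i.rev).trans ?_⟩
  · rw [← hrange]
    exact Fin.rev_surjective.range_comp W
  · refine iSup_le fun j => iSup_le fun hj => ?_
    have hle : (j.rev : ℕ) ≤ i + 1 ∧ (i : ℕ) ≤ j.rev + 1 := by
      simp only [Fin.val_rev] at hj ⊢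
      omega
    refine le_trans ?_ (le_iSup₂_of_le j.rev hle le_rfl)
    simp

theorem IsStandardIdempotents.rev {A B : Module.End F V} {d : ℕ}
    {E : Fin (d + 1) → Module.End F V} (h : IsStandardIdempotents A B E) :
    IsStandardIdempotents A B (fun i => E i.rev) := by
  obtain ⟨W, hW, hE⟩ := h
  exact ⟨fun i => W i.rev, hW.rev, fun i => ⟨(hE i.rev).1,
    fun j hj => (hE i.rev).2 j.rev fun hh => hj (Fin.rev_injective hh)⟩⟩

/-- The image of a primitive idempotent of a diagonalizable map is an eigenspace. -/
theorem IsStandardIdempotents.exists_eigenvalue {A B : Module.End F V} {d : ℕ}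
    {E : Fin (d + 1) → Module.End F V} (h : IsStandardIdempotents A B E)
    (hA : IsDiagonalizableEnd A) (i : Fin (d + 1)) :
    ∃ θ : F, LinearMap.range (E i) = A.eigenspace θ := by
  obtain ⟨W, ⟨⟨_, hrange⟩, _⟩, hE⟩ := h
  obtain ⟨_, θ, hθ⟩ : W i ∈ {U | U ≠ ⊥ ∧ ∃ θ : F, U = A.eigenspace θ} :=
    hrange ▸ Set.mem_range_self i
  refine ⟨θ, ?_⟩
  rw [← hθ]
  apply le_antisymm
  · rw [LinearMap.range_eq_map, ← hA, Submodule.map_iSup]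
    refine iSup_le fun μ => ?_
    rintro _ ⟨v, hv, rfl⟩
    by_cases hbot : A.eigenspace μ = ⊥
    · have : v = 0 := by simpa [hbot] using hv
      simp [this]
    · obtain ⟨j, hj⟩ : A.eigenspace μ ∈ Set.range W := hrange ▸ ⟨hbot, μ, rfl⟩
      have hv' : v ∈ W j := hj ▸ hv
      by_cases hji : j = i
      · subst hji
        rw [(hE j).1 v hv']
        exact hv'
      · rw [(hE i).2 j hji v hv']
        exact zero_mem _
  · exact fun v hv => ⟨v, (hE i).1 v hv⟩

end Pairs

/-! ### Tridiagonal systems -/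

/-- A tridiagonal system `(A; E₀,…,E_d; A*; E*₀,…,E*_d)` of diameter `d` on `V`. -/
@[ext]
structure TridiagonalSystem (F V : Type*) [Field F] [AddCommGroup V] [Module F V] (d : ℕ) where
  A : Module.End F V
  E : Fin (d + 1) → Module.End F V
  As : Module.End F V
  Es : Fin (d + 1) → Module.End F V
  isPair : IsTridiagonalPair A As
  standard : IsStandardIdempotents A As E
  standard_dual : IsStandardIdempotents As A Es

namespace TridiagonalSystem

variable {F V : Type*} [Field F] [AddCommGroup V] [Module F V] {d : ℕ}

/-- `Φ ↦ Φ^*`. -/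
def star (Φ : TridiagonalSystem F V d) : TridiagonalSystem F V d :=
  ⟨Φ.As, Φ.Es, Φ.A, Φ.E, Φ.isPair.swap, Φ.standard_dual, Φ.standard⟩

/-- `Φ ↦ Φ^↓`, which reverses the ordering of the `E*ᵢ`. -/
def down (Φ : TridiagonalSystem F V d) : TridiagonalSystem F V d :=
  ⟨Φ.A, Φ.E, Φ.As, fun i => Φ.Es i.rev, Φ.isPair, Φ.standard, Φ.standard_dual.rev⟩

/-- `Φ ↦ Φ^⇓`, which reverses the ordering of the `Eᵢ`. -/
def ddown (Φ : TridiagonalSystem F V d) : TridiagonalSystem F V d :=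
  ⟨Φ.A, fun i => Φ.E i.rev, Φ.As, Φ.Es, Φ.isPair, Φ.standard.rev, Φ.standard_dual⟩

theorem star_star (Φ : TridiagonalSystem F V d) : Φ.star.star = Φ := rfl

theorem down_down (Φ : TridiagonalSystem F V d) : Φ.down.down = Φ := by
  ext1 <;> simp [down]

theorem ddown_ddown (Φ : TridiagonalSystem F V d) : Φ.ddown.ddown = Φ := by
  ext1 <;> simp [ddown]

/-- `Φ` is sharp: `dim E₀V = 1`. -/
def IsSharp (Φ : TridiagonalSystem F V d) : Prop :=
  Module.finrank F (LinearMap.range (Φ.E 0)) = 1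

/-- `θᵢ`, the eigenvalue of `A` associated with `EᵢV` (and `0` for `i > d`). -/
noncomputable def theta (Φ : TridiagonalSystem F V d) (i : ℕ) : F :=
  if h : i < d + 1 then
    (Φ.standard.exists_eigenvalue Φ.isPair.diag ⟨i, h⟩).choose
  else 0

/-- `θ*ᵢ`, the eigenvalue of `A*` associated with `E*ᵢV` (and `0` for `i > d`). -/
noncomputable def thetas (Φ : TridiagonalSystem F V d) (i : ℕ) : F :=
  Φ.star.theta i

/-- The map `(A* - θ*₁)(A* - θ*₂)⋯(A* - θ*ᵢ)(A - θ_{i-1})⋯(A - θ₁)(A - θ₀)`. -/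
noncomputable def splitMap (Φ : TridiagonalSystem F V d) (i : ℕ) : Module.End F V :=
  aeval Φ.As (∏ h ∈ Finset.range i, (X - C (Φ.thetas (h + 1)))) *
    aeval Φ.A (∏ h ∈ Finset.range i, (X - C (Φ.theta h)))

/-- `z` is the eigenvalue of the `i`-th split map on the space `U₀ = E*₀V`. -/
def IsSplitValue (Φ : TridiagonalSystem F V d) (i : ℕ) (z : F) : Prop :=
  ∀ v ∈ LinearMap.range (Φ.Es 0), Φ.splitMap i v = z • v

open Classical in
/-- The split sequence `ζᵢ` of a sharp tridiagonal system. -/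
noncomputable def zeta (Φ : TridiagonalSystem F V d) (i : ℕ) : F :=
  if h : ∃ z : F, Φ.IsSplitValue i z then h.choose else 0

/-- `β` is a base of `Φ`: for `d ≥ 3`, `β + 1` is the common value of the two ratios for
`2 ≤ i ≤ d - 1`; for `d ≤ 2`, `β` is any nonzero scalar. -/
def IsBase (Φ : TridiagonalSystem F V d) (β : F) : Prop :=
  if 3 ≤ d then
    ∀ i : ℕ, 2 ≤ i → i ≤ d - 1 →
      (Φ.theta (i - 2) - Φ.theta (i + 1)) / (Φ.theta (i - 1) - Φ.theta i) = β + 1 ∧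
      (Φ.thetas (i - 2) - Φ.thetas (i + 1)) / (Φ.thetas (i - 1) - Φ.thetas i) = β + 1
  else β ≠ 0

/-- `θᵢ` as an element of the algebraic closure. -/
noncomputable def thetaBar (Φ : TridiagonalSystem F V d) (i : ℕ) : AlgebraicClosure F :=
  algebraMap F (AlgebraicClosure F) (Φ.theta i)

/-- `θ*ᵢ` as an element of the algebraic closure. -/
noncomputable def thetasBar (Φ : TridiagonalSystem F V d) (i : ℕ) : AlgebraicClosure F :=
  algebraMap F (AlgebraicClosure F) (Φ.thetas i)

/-- `ζᵢ` as an element of the algebraic closure. -/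
noncomputable def zetaBar (Φ : TridiagonalSystem F V d) (i : ℕ) : AlgebraicClosure F :=
  algebraMap F (AlgebraicClosure F) (Φ.zeta i)

end TridiagonalSystem

/-! ### Types -/

/-- The five types of tridiagonal systems. -/
inductive TDType
  | I | II | IIIplus | IIIminus | IV

open Classical in
/-- The type attached to a base `β` and a diameter `d`. In characteristic `2` one has
`2 = -2 = 0`, so the last case is `β = 0`, `Char F = 2`. -/
noncomputable def tdType {F : Type*} [Field F] (β : F) (d : ℕ) : TDType :=
  if β ≠ 2 ∧ β ≠ -2 then TDType.I
  else if ringChar F ≠ 2 then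
    if β = 2 then TDType.II
    else if Even d then TDType.IIIplus else TDType.IIIminus
  else TDType.IV

/-! ### The auxiliary scalars `q, a, b, c, a*, b*, c*` -/

/-- Scalars `q, a, b, c, a*, b*, c*` in a field `K`; `q` is used for type I only. -/
@[ext]
structure TDScalars (K : Type*) where
  q : K
  a : K
  b : K
  c : K
  as : K
  bs : K
  cs : K

namespace TDScalars

variable {K : Type*}

/-- The scalars for `Φ^*` obtained from those for `Φ` (type I). -/
def star (e : TDScalars K) : TDScalars K := ⟨e.q, e.as, e.bs, e.cs, e.a, e.b, e.c⟩

/-- The scalars for `Φ^↓` obtained from those for `Φ` (type I). -/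
def down (e : TDScalars K) : TDScalars K := ⟨e.q, e.a, e.b, e.c, e.as, e.cs, e.bs⟩

/-- The scalars for `Φ^⇓` obtained from those for `Φ` (type I). -/
def ddown (e : TDScalars K) : TDScalars K := ⟨e.q, e.a, e.c, e.b, e.as, e.bs, e.cs⟩

end TDScalars

/-! ### The group `D₄` and its actions -/

/-- The generators `*`, `↓`, `⇓` of `D₄`. -/
inductive D4Gen
  | star | down | ddown

/-- The defining relations of `D₄`: `*² = ↓² = ⇓² = 1`, `⇓* = *↓`, `↓* = *⇓`, `↓⇓ = ⇓↓`. -/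
def D4Rels : Set (FreeGroup D4Gen) :=
  let s := FreeGroup.of D4Gen.star
  let r := FreeGroup.of D4Gen.down
  let t := FreeGroup.of D4Gen.ddown
  {s * s, r * r, t * t, t * s * (s * r)⁻¹, r * s * (s * t)⁻¹, r * t * (t * r)⁻¹}

/-- The dihedral group `D₄`, by generators and relations. -/
abbrev D4 : Type := PresentedGroup D4Rels

/-- The permutations of the set of tridiagonal systems given by the generators. -/
def TridiagonalSystem.genPerm {F V : Type*} [Field F] [AddCommGroup V] [Module F V] {d : ℕ} :
    D4Gen → Equiv.Perm (TridiagonalSystem F V d)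
  | .star => Function.Involutive.toPerm _ TridiagonalSystem.star_star
  | .down => Function.Involutive.toPerm _ TridiagonalSystem.down_down
  | .ddown => Function.Involutive.toPerm _ TridiagonalSystem.ddown_ddown

/-- The permutations of the set of scalars given by the generators. -/
def TDScalars.genPerm {K : Type*} : D4Gen → Equiv.Perm (TDScalars K)
  | .star => Function.Involutive.toPerm TDScalars.star fun _ => rfl
  | .down => Function.Involutive.toPerm TDScalars.down fun _ => rfl
  | .ddown => Function.Involutive.toPerm TDScalars.ddown fun _ => rfl

theorem TridiagonalSystem.genPerm_rels {F V : Type*} [Field F] [AddCommGroup V] [Module F V]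
    {d : ℕ} : ∀ r ∈ D4Rels, FreeGroup.lift
      (TridiagonalSystem.genPerm (F := F) (V := V) (d := d)) r = 1 := by
  intro r hr
  simp only [D4Rels, Set.mem_insert_iff, Set.mem_singleton_iff] at hr
  rcases hr with rfl | rfl | rfl | rfl | rfl | rfl
  · rw [map_mul]; simp only [FreeGroup.lift_apply_of]; ext1 Φ; exact star_star Φ
  · rw [map_mul]; simp only [FreeGroup.lift_apply_of]; ext1 Φ; exact down_down Φ
  · rw [map_mul]; simp only [FreeGroup.lift_apply_of]; ext1 Φ; exact ddown_ddown Φ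
  all_goals
    rw [map_mul, map_inv, mul_inv_eq_one, map_mul, map_mul]
    simp only [FreeGroup.lift_apply_of]
    ext1 Φ
    rfl

theorem TDScalars.genPerm_rels {K : Type*} : ∀ r ∈ D4Rels, FreeGroup.lift
    (TDScalars.genPerm (K := K)) r = 1 := by
  intro r hr
  simp only [D4Rels, Set.mem_insert_iff, Set.mem_singleton_iff] at hr
  rcases hr with rfl | rfl | rfl | rfl | rfl | rfl
  · rw [map_mul]; simp only [FreeGroup.lift_apply_of]; ext1 e; rfl
  · rw [map_mul]; simp only [FreeGroup.lift_apply_of]; ext1 e; rfl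
  · rw [map_mul]; simp only [FreeGroup.lift_apply_of]; ext1 e; rfl
  all_goals
    rw [map_mul, map_inv, mul_inv_eq_one, map_mul, map_mul]
    simp only [FreeGroup.lift_apply_of]
    ext1 e
    rfl

/-- The action of `D₄` on tridiagonal systems, written on the left: `d4 g Φ = Φ^{g⁻¹}`. -/
def TridiagonalSystem.d4 {F V : Type*} [Field F] [AddCommGroup V] [Module F V] {d : ℕ} :
    D4 →* Equiv.Perm (TridiagonalSystem F V d) :=
  PresentedGroup.toGroup TridiagonalSystem.genPerm_rels

/-- The corresponding action of `D₄` on scalars (used for type I only). -/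
def TDScalars.d4 {K : Type*} : D4 →* Equiv.Perm (TDScalars K) :=
  PresentedGroup.toGroup TDScalars.genPerm_rels

namespace TridiagonalSystem

variable {F V : Type*} [Field F] [AddCommGroup V] [Module F V] {d : ℕ}

/-- The six scalars `a, b, c, a*, b*, c*` belong to `F`. -/
def _root_.TDScalars.IsRational (e : TDScalars (AlgebraicClosure F)) : Prop :=
  ∀ x ∈ [e.a, e.b, e.c, e.as, e.bs, e.cs], x ∈ (algebraMap F (AlgebraicClosure F)).range

/-- `e` is a system of scalars expressing the eigenvalue and dual eigenvalue sequences of `Φ`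
in closed form, according to the type given by the base `β`. -/
def IsScalars (Φ : TridiagonalSystem F V d) (β : F) (e : TDScalars (AlgebraicClosure F)) : Prop :=
  match tdType β d with
  | .I =>
      e.q ≠ 0 ∧ e.q ^ 2 + (e.q⁻¹) ^ 2 = algebraMap F (AlgebraicClosure F) β ∧
      ∀ i : ℕ, i ≤ d →
        Φ.thetaBar i =
          e.a + e.b * e.q ^ (2 * (i : ℤ) - d) + e.c * e.q ^ ((d : ℤ) - 2 * i) ∧
        Φ.thetasBar i =
          e.as + e.bs * e.q ^ (2 * (i : ℤ) - d) + e.cs * e.q ^ ((d : ℤ) - 2 * i)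
  | .II =>
      e.IsRational ∧
      ∀ i : ℕ, i ≤ d →
        Φ.thetaBar i = e.a + e.b * ((i : AlgebraicClosure F) - d / 2) + e.c * i * (d - i) ∧
        Φ.thetasBar i = e.as + e.bs * ((i : AlgebraicClosure F) - d / 2) + e.cs * i * (d - i)
  | .IIIplus | .IIIminus =>
      e.IsRational ∧
      ∀ i : ℕ, i ≤ d →
        (Φ.thetaBar i = if Even i then e.a + e.b + e.c * ((i : AlgebraicClosure F) - d / 2)
          else e.a - e.b - e.c * ((i : AlgebraicClosure F) - d / 2)) ∧
        (Φ.thetasBar i = if Even i then e.as + e.bs + e.cs * ((i : AlgebraicClosure F) - d / 2)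
          else e.as - e.bs - e.cs * ((i : AlgebraicClosure F) - d / 2))
  | .IV =>
      d = 3 ∧ e.IsRational ∧
      (Φ.thetaBar 0 = e.a ∧ Φ.thetaBar 1 = e.b + e.c ∧
        Φ.thetaBar 2 = e.a + e.c ∧ Φ.thetaBar 3 = e.b) ∧
      (Φ.thetasBar 0 = e.as ∧ Φ.thetasBar 1 = e.bs + e.cs ∧
        Φ.thetasBar 2 = e.as + e.cs ∧ Φ.thetasBar 3 = e.bs)

/-! ### The Drinfel'd polynomial `P` -/

/-- The scalar `αᵢ`. For type III⁺ this is `i²/d²` for even `i` and `1` for odd `i`. -/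
noncomputable def alpha (β : F) (d : ℕ) (q : AlgebraicClosure F) (i : ℕ) : AlgebraicClosure F :=
  match tdType β d with
  | .I => (q ^ i - (q⁻¹) ^ i) ^ 2 / (q ^ d - (q⁻¹) ^ d) ^ 2
  | .II => (i : AlgebraicClosure F) ^ 2 / (d : AlgebraicClosure F) ^ 2
  | .IIIplus => if Even i then (i : AlgebraicClosure F) ^ 2 / (d : AlgebraicClosure F) ^ 2 else 1
  | .IIIminus | .IV => if Even i then 0 else 1

/-- The polynomial `pᵢ`. For type III⁺ and `i` odd the constant summand is absent. -/
noncomputable def p (Φ : TridiagonalSystem F V d) (β : F) (q : AlgebraicClosure F) (i : ℕ) :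
    (AlgebraicClosure F)[X] :=
  let main : (AlgebraicClosure F)[X] :=
    (C (Φ.thetaBar 0 * Φ.thetasBar d + Φ.thetaBar d * Φ.thetasBar 0) - X) * C (alpha β d q i)
  let const : (AlgebraicClosure F)[X] :=
    C ((Φ.thetaBar 0 - Φ.thetaBar i) * (Φ.thetasBar 0 - Φ.thetasBar i))
  match tdType β d with
  | .IIIplus => if Even i then main + const else main
  | _ => main + const

/-- The Drinfel'd polynomial `P` of `Φ`. -/
noncomputable def drinfeld (Φ : TridiagonalSystem F V d) (β : F) (q : AlgebraicClosure F) :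
    (AlgebraicClosure F)[X] :=
  match tdType β d with
  | .IIIplus => ∏ i ∈ Finset.Icc 1 d, Φ.p β q i
  | _ => ∑ i ∈ Finset.range (d + 1), C (Φ.zetaBar i) * ∏ j ∈ Finset.Icc (i + 1) d, Φ.p β q j

/-! ### The normalized Drinfel'd polynomial -/

/-- The polynomial `p̂ᵢ` (not used for type III⁺). -/
noncomputable def _root_.TDScalars.hatp (β : F) (d : ℕ) (e : TDScalars (AlgebraicClosure F))
    (i : ℕ) : (AlgebraicClosure F)[X] :=
  match tdType β d with
  | .I =>
      C ((e.q ^ i - (e.q⁻¹) ^ i) ^ 2) *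
        (C (e.b * e.bs * e.q ^ (2 * (i : ℤ) - 2 * d) + e.c * e.cs * e.q ^ (2 * (d : ℤ) - 2 * i))
          - X)
  | .II =>
      C ((i : AlgebraicClosure F) ^ 2) *
        (C (e.b * e.bs / 2 + (e.b * e.cs + e.c * e.bs) * ((d : AlgebraicClosure F) - i)
          + e.c * e.cs * ((d : AlgebraicClosure F) - i) ^ 2) - X)
  | .IIIplus => 0
  | .IIIminus =>
      if Even i then C (e.c * e.cs * (i : AlgebraicClosure F) ^ 2)
      else
        C (2 * e.b * e.bs + 2 * (e.b * e.cs + e.c * e.bs) * ((i : AlgebraicClosure F) - d)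
          + e.c * e.cs * ((i : AlgebraicClosure F) - d) ^ 2) - X
  | .IV =>
      if i = 1 then
        C (e.a * e.bs + e.b * e.as + (e.a + e.b + e.c) * (e.as + e.bs + e.cs)) + X
      else if i = 2 then C (e.c * e.cs)
      else C (e.a * e.bs + e.b * e.as + (e.a + e.b) * (e.as + e.bs)) + X

/-- The normalized Drinfel'd polynomial `P̂` of `Φ`, computed with the scalars `e`. -/
noncomputable def normalizedDrinfeld (Φ : TridiagonalSystem F V d) (β : F)
    (e : TDScalars (AlgebraicClosure F)) : (AlgebraicClosure F)[X] :=
  match tdType β d with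
  | .IIIplus => Φ.drinfeld β e.q
  | _ => ∑ i ∈ Finset.range (d + 1), C (Φ.zetaBar i) * ∏ j ∈ Finset.Icc (i + 1) d, e.hatp β d j

/-- The scalar `u` in `P̂(λ) = P(uλ + v)`. -/
noncomputable def _root_.TDScalars.u (β : F) (d : ℕ) (e : TDScalars (AlgebraicClosure F)) :
    AlgebraicClosure F :=
  match tdType β d with
  | .I => (e.q ^ d - (e.q⁻¹) ^ d) ^ 2
  | .II => (d : AlgebraicClosure F) ^ 2
  | .IIIplus | .IIIminus | .IV => 1

/-- The scalar `v` in `P̂(λ) = P(uλ + v)`. -/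
noncomputable def _root_.TDScalars.v (β : F) (d : ℕ) (e : TDScalars (AlgebraicClosure F)) :
    AlgebraicClosure F :=
  match tdType β d with
  | .I =>
      2 * e.a * e.as + 2 * (e.b + e.c) * (e.bs + e.cs)
        + (e.q ^ d + (e.q⁻¹) ^ d) * e.a * (e.bs + e.cs)
        + (e.q ^ d + (e.q⁻¹) ^ d) * e.as * (e.b + e.c)
  | .II => 2 * e.a * e.as
  | .IIIminus => (2 * e.a - e.c * d) * (2 * e.as - e.cs * d) / 2
  | .IIIplus | .IV => 0

end TridiagonalSystem

/-! Let `e` span `E*₀V` and let `E*₀ Eⱼ e = μⱼ e`. Since `A - θᵢ` raises and `A* - θ*ᵢ` lowers the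
split decomposition of `V`, the number `ζᵢ` is, up to the factor `∏_{1≤k≤i} (θ*₀ - θ*ₖ)`, the moment
`∑ⱼ μⱼ ∏_{k<i} (θⱼ - θₖ)`. The system `Φ^⇓` has the same weights `μⱼ`, with the nodes `θ₀, …, θ_d`
in reversed order, so that passing from `Φ` to `Φ^⇓` is a change of Newton basis. After the closed
forms of `θᵢ` and `θ*ᵢ` are inserted, the products `p̂_{i+1} ⋯ p̂_d` of `Φ` and of `Φ^⇓` turn out to
be two sides of one triangular table of divided differences, whence `∑ ζᵢ p̂_{i+1} ⋯ p̂_d` does not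
change. The sequences `ζ` of `Φ` and `Φ*` agree, because the flags defining the split decomposition
kill the lower order terms by which the two defining products differ.

The scalars `q, a, b, c, …` are unique up to symmetries that fix every `p̂ᵢ` (except for type I with
`d = 1`), so invariance under all of `D₄` follows from invariance under its generators. -/

open Lagrange (nodal)

section EigenspaceOrderings

variable {F V : Type*} [Field F] [AddCommGroup V] [Module F V] {d : ℕ} {A B : Module.End F V}
  {W : Fin (d + 1) → Submodule F V}

theorem IsEigenspaceOrdering.iSup_eq_top (hW : IsEigenspaceOrdering A W)
    (hA : IsDiagonalizableEnd A) : ⨆ i, W i = ⊤ := by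
  refine eq_top_iff.2 (hA.ge.trans (iSup_le fun θ => ?_))
  by_cases hbot : A.eigenspace θ = ⊥
  · exact hbot ▸ bot_le
  · obtain ⟨i, hi⟩ : A.eigenspace θ ∈ Set.range W := hW.2 ▸ ⟨hbot, θ, rfl⟩
    exact hi ▸ le_iSup W i

theorem IsEigenspaceOrdering.hom_ext (hW : IsEigenspaceOrdering A W) (hA : IsDiagonalizableEnd A)
    {f g : Module.End F V} (h : ∀ i, ∀ v ∈ W i, f v = g v) : f = g := by
  have hle : ⨆ i, W i ≤ LinearMap.eqLocus f g := iSup_le h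
  exact LinearMap.eqLocus_eq_top.1 (top_le_iff.1 (hW.iSup_eq_top hA ▸ hle))

end EigenspaceOrderings

section NodalPolynomials

variable {R M : Type*} [CommRing R] [AddCommGroup M] [Module R M]

theorem nodal_range_succ (s : ℕ → R) (n : ℕ) :
    nodal (Finset.range (n + 1)) s = nodal (Finset.range n) s * (X - C (s n)) :=
  Finset.prod_range_succ _ _

theorem aeval_nodal_range_succ (B : Module.End R M) (s : ℕ → R) (n : ℕ) (v : M) :
    aeval B (nodal (Finset.range (n + 1)) s) v =
      aeval B (nodal (Finset.range n) s) (B v - s n • v) := by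
  simp [nodal_range_succ, Module.End.mul_apply, Algebra.algebraMap_eq_smul_one]

theorem aeval_nodal_range_succ' (B : Module.End R M) (s : ℕ → R) (n : ℕ) (v : M) :
    aeval B (nodal (Finset.range (n + 1)) s) v =
      B (aeval B (nodal (Finset.range n) s) v) - s n • aeval B (nodal (Finset.range n) s) v := by
  rw [nodal_range_succ, mul_comm]
  simp [Module.End.mul_apply, Algebra.algebraMap_eq_smul_one]

theorem degree_nodal_sub_nodal_lt [Nontrivial R] {ι : Type*} (t : Finset ι) (s s' : ι → R) :
    (nodal t s - nodal t s').degree < t.card := by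
  rw [← Lagrange.degree_nodal (s := t) (v := s)]
  refine degree_sub_lt_left ?_ Lagrange.nodal_ne_zero ?_
  · rw [Lagrange.degree_nodal, Lagrange.degree_nodal]
  · rw [Lagrange.nodal_monic.leadingCoeff, Lagrange.nodal_monic.leadingCoeff]

theorem exists_natDegree_le_eval_sub_eval_succ {K : Type*} [Field K] {x : ℕ → K} {d : ℕ}
    (hx : Set.InjOn x (Finset.range (d + 1))) (g : ℕ → K) :
    ∃ z : K[X], z.natDegree ≤ d ∧ ∀ i < d, z.eval (x i) - z.eval (x (i + 1)) = g i := by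
  set r : ℕ → K := fun i => -∑ h ∈ Finset.range i, g h with hr
  refine ⟨Lagrange.interpolate (Finset.range (d + 1)) x r, ?_, fun i hi => ?_⟩
  · exact natDegree_le_of_degree_le (by simpa using Lagrange.degree_interpolate_le r hx)
  · rw [Lagrange.eval_interpolate_at_node r hx (Finset.mem_range.2 (by lia)),
      Lagrange.eval_interpolate_at_node r hx (Finset.mem_range.2 (by lia)), hr]
    simp only [Finset.sum_range_succ]
    ring

theorem coeff_three_mul_sub_of_eval_sub_eval {K : Type*} [Field K] {z : K[X]}
    (hz : z.natDegree ≤ 3) {x : ℕ → K}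
    (heval : ∀ i < 3, z.eval (x i) - z.eval (x (i + 1)) = x i * x (i + 1) * (x i - x (i + 1)))
    (hx : Set.InjOn x (Finset.range 4)) :
    z.coeff 3 * (x 0 - x 3) = x 1 - x 2 := by
  have hne : ∀ i < 4, ∀ j < 4, i ≠ j → x i - x j ≠ 0 := fun i hi j hj hij =>
    sub_ne_zero.2 fun h => hij (hx (by simpa using hi) (by simpa using hj) h)
  have hcubic : ∀ y, z.eval y =
      z.coeff 0 + z.coeff 1 * y + z.coeff 2 * y ^ 2 + z.coeff 3 * y ^ 3 := fun y => by
    rw [eval_eq_sum_range' (Nat.lt_succ_of_le hz)]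
    simp [Finset.sum_range_succ]
  have hfirst : ∀ i < 3, z.coeff 3 * (x i ^ 2 + x i * x (i + 1) + x (i + 1) ^ 2) +
      z.coeff 2 * (x i + x (i + 1)) + z.coeff 1 = x i * x (i + 1) := fun i hi => by
    have h := heval i hi
    rw [hcubic, hcubic] at h
    apply mul_right_cancel₀ (hne i (by lia) (i + 1) (by lia) (by lia))
    linear_combination h
  have hsecond : ∀ i < 2, z.coeff 3 * (x i + x (i + 1) + x (i + 2)) + z.coeff 2 = x (i + 1) :=
    fun i hi => by
      apply mul_right_cancel₀ (hne i (by lia) (i + 2) (by lia) (by lia))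
      linear_combination hfirst i (by lia) - hfirst (i + 1) (by lia)
  linear_combination hsecond 0 (by lia) - hsecond 1 (by lia)

end NodalPolynomials

namespace TridiagonalSystem

variable {F V : Type*} [Field F] [AddCommGroup V] [Module F V] {d : ℕ}

section PrimitiveIdempotents

variable (Φ : TridiagonalSystem F V d)

theorem range_E (i : Fin (d + 1)) : LinearMap.range (Φ.E i) = Φ.A.eigenspace (Φ.theta i) := by
  rw [theta, dif_pos i.2]
  exact (Φ.standard.exists_eigenvalue Φ.isPair.diag i).choose_spec

theorem exists_ordering : ∃ W : Fin (d + 1) → Submodule F V, IsStandardOrdering Φ.A Φ.As W ∧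
    (∀ i, ∀ v ∈ W i, Φ.E i v = v) ∧ (∀ i j, j ≠ i → ∀ v ∈ W j, Φ.E i v = 0) ∧
    ∀ i, LinearMap.range (Φ.E i) = W i := by
  obtain ⟨W, hW, hE⟩ := Φ.standard
  refine ⟨W, hW, fun i => (hE i).1, fun i => (hE i).2, fun i => le_antisymm ?_ ?_⟩
  · rw [LinearMap.range_eq_map, ← hW.1.iSup_eq_top Φ.isPair.diag, Submodule.map_iSup]
    refine iSup_le fun j => ?_
    rintro _ ⟨v, hv, rfl⟩
    obtain rfl | hji := eq_or_ne j i
    · exact ((hE j).1 v hv).symm ▸ hv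
    · exact ((hE i).2 j hji v hv).symm ▸ zero_mem _
  · exact fun v hv => ⟨v, (hE i).1 v hv⟩

theorem E_mul_E_self (i : Fin (d + 1)) : Φ.E i * Φ.E i = Φ.E i := by
  obtain ⟨W, -, hid, -, hrange⟩ := Φ.exists_ordering
  exact LinearMap.ext fun v => hid i _ (hrange i ▸ LinearMap.mem_range_self _ v)

theorem E_mul_E_of_ne {i j : Fin (d + 1)} (h : i ≠ j) : Φ.E i * Φ.E j = 0 := by
  obtain ⟨W, -, -, hzero, hrange⟩ := Φ.exists_ordering
  exact LinearMap.ext fun v => hzero i j h.symm _ (hrange j ▸ LinearMap.mem_range_self _ v)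

theorem sum_E : ∑ i, Φ.E i = 1 := by
  obtain ⟨W, hW, hid, hzero, -⟩ := Φ.exists_ordering
  refine hW.1.hom_ext Φ.isPair.diag fun i v hv => ?_
  rw [LinearMap.sum_apply, Finset.sum_eq_single i (fun j _ hj => hzero j i hj.symm v hv) (by simp)]
  exact hid i v hv

theorem sum_E_apply (v : V) : ∑ i, Φ.E i v = v := by
  rw [← LinearMap.sum_apply, Φ.sum_E, Module.End.one_apply]

theorem A_E_apply (i : Fin (d + 1)) (v : V) : Φ.A (Φ.E i v) = Φ.theta i • Φ.E i v :=
  Module.End.mem_eigenspace_iff.1 (Φ.range_E i ▸ LinearMap.mem_range_self _ v)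

theorem aeval_A_E_apply (i : Fin (d + 1)) (f : F[X]) (v : V) :
    aeval Φ.A f (Φ.E i v) = f.eval (Φ.theta i) • Φ.E i v :=
  Module.End.aeval_apply_of_mem_apply_eq_smul (Φ.A_E_apply i v)

theorem E_aeval_A_apply (i : Fin (d + 1)) (f : F[X]) (v : V) :
    Φ.E i (aeval Φ.A f v) = f.eval (Φ.theta i) • Φ.E i v := by
  conv_lhs => rw [← Φ.sum_E_apply v, map_sum, map_sum]
  rw [Finset.sum_eq_single i _ (by simp)]
  · rw [aeval_A_E_apply, map_smul, ← Module.End.mul_apply, E_mul_E_self]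
  · intro j _ hji
    rw [aeval_A_E_apply, map_smul, ← Module.End.mul_apply, E_mul_E_of_ne _ hji.symm,
      LinearMap.zero_apply, smul_zero]

theorem E_A_apply (i : Fin (d + 1)) (v : V) : Φ.E i (Φ.A v) = Φ.theta i • Φ.E i v := by
  simpa using Φ.E_aeval_A_apply i X v

theorem Es_As_apply (i : Fin (d + 1)) (v : V) : Φ.Es i (Φ.As v) = Φ.thetas i • Φ.Es i v :=
  Φ.star.E_A_apply i v

theorem E_As_E_apply_eq_zero {i j : Fin (d + 1)} (h : (i : ℕ) + 1 < j ∨ (j : ℕ) + 1 < i) (v : V) :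
    Φ.E i (Φ.As (Φ.E j v)) = 0 := by
  obtain ⟨W, hW, -, hzero, hrange⟩ := Φ.exists_ordering
  have hle : (W j).map Φ.As ≤ LinearMap.ker (Φ.E i) :=
    (hW.2 j).trans (iSup₂_le fun k hk => hzero i k (by rintro rfl; lia))
  exact hle ⟨_, hrange j ▸ LinearMap.mem_range_self _ v, rfl⟩

theorem hom_ext_E {f g : Module.End F V}
    (h : ∀ i j v, Φ.E i (f (Φ.E j v)) = Φ.E i (g (Φ.E j v))) : f = g := by
  ext v
  rw [← Φ.sum_E_apply v, map_sum, map_sum]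
  refine Finset.sum_congr rfl fun j _ => ?_
  rw [← Φ.sum_E_apply (f _), ← Φ.sum_E_apply (g _)]
  exact Finset.sum_congr rfl fun i _ => h i j v

theorem E_ne_zero (i : Fin (d + 1)) : Φ.E i ≠ 0 := by
  obtain ⟨W, hW, -, -, hrange⟩ := Φ.exists_ordering
  obtain ⟨hbot, -⟩ : W i ∈ {U | U ≠ ⊥ ∧ ∃ θ : F, U = Φ.A.eigenspace θ} :=
    hW.1.2 ▸ Set.mem_range_self i
  rwa [← hrange i, Ne, LinearMap.range_eq_bot] at hbot

theorem exists_E_apply_ne_zero (i : Fin (d + 1)) : ∃ v, Φ.E i v ≠ 0 := by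
  by_contra! h
  exact Φ.E_ne_zero i (LinearMap.ext h)

theorem theta_injOn : Set.InjOn Φ.theta (Finset.range (d + 1)) := by
  intro i hi j hj hij
  obtain ⟨W, hW, -, -, hrange⟩ := Φ.exists_ordering
  have hWi := Φ.range_E ⟨i, by simpa using hi⟩
  have hWj := Φ.range_E ⟨j, by simpa using hj⟩
  rw [hrange] at hWi hWj
  exact congrArg Fin.val (hW.1.1 (hWi.trans (hij ▸ hWj.symm)))

theorem theta_ne {i j : ℕ} (hi : i ≤ d) (hj : j ≤ d) (h : i ≠ j) : Φ.theta i ≠ Φ.theta j :=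
  fun hij => h (Φ.theta_injOn (by simp; lia) (by simp; lia) hij)

theorem thetas_ne {i j : ℕ} (hi : i ≤ d) (hj : j ≤ d) (h : i ≠ j) : Φ.thetas i ≠ Φ.thetas j :=
  Φ.star.theta_ne hi hj h

theorem theta_eq_of_range_E {i : Fin (d + 1)} {θ : F}
    (h : LinearMap.range (Φ.E i) = Φ.A.eigenspace θ) : Φ.theta i = θ := by
  obtain ⟨v, hv⟩ := Φ.exists_E_apply_ne_zero i
  have hθ := Module.End.mem_eigenspace_iff.1 (h ▸ LinearMap.mem_range_self (Φ.E i) v)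
  exact smul_left_injective F hv ((Φ.A_E_apply i v).symm.trans hθ)

theorem theta_ddown {i : ℕ} (hi : i ≤ d) : Φ.ddown.theta i = Φ.theta (d - i) := by
  have h := Φ.ddown.theta_eq_of_range_E (i := ⟨i, by lia⟩) (Φ.range_E (Fin.rev ⟨i, by lia⟩))
  rwa [Fin.val_rev, Nat.add_sub_add_right] at h

theorem thetas_down {i : ℕ} (hi : i ≤ d) : Φ.down.thetas i = Φ.thetas (d - i) :=
  Φ.star.theta_ddown hi

end PrimitiveIdempotents

section Flags

/-- The subspace `E*₀V + ⋯ + E*_{n-1}V`, encoded as the common kernel of `E*_n, …, E*_d`. -/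
def lowerFlag (Φ : TridiagonalSystem F V d) (n : ℕ) : Submodule F V :=
  ⨅ j : Fin (d + 1), ⨅ _ : n ≤ j, LinearMap.ker (Φ.Es j)

/-- The subspace `E_mV + ⋯ + E_dV`, encoded as the common kernel of `E_0, …, E_{m-1}`. -/
def upperFlag (Φ : TridiagonalSystem F V d) (m : ℕ) : Submodule F V :=
  ⨅ j : Fin (d + 1), ⨅ _ : (j : ℕ) < m, LinearMap.ker (Φ.E j)

/-- The subspace `(E*₀V + ⋯ + E*_{n+k-1}V) ∩ (E_nV + ⋯ + E_dV)`. For `k = 1` and `0 ≤ n ≤ d` these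
are the components `Uₙ` of the split decomposition; the shift `k` lets the same raising and lowering
maps be used for its neighbours. -/
def splitComponent (Φ : TridiagonalSystem F V d) (k n : ℕ) : Submodule F V :=
  Φ.lowerFlag (n + k) ⊓ Φ.upperFlag n

variable {Φ : TridiagonalSystem F V d} {v : V}

theorem mem_lowerFlag {n : ℕ} : v ∈ Φ.lowerFlag n ↔ ∀ j : Fin (d + 1), n ≤ j → Φ.Es j v = 0 := by
  simp [lowerFlag, Submodule.mem_iInf]

theorem mem_upperFlag {m : ℕ} :
    v ∈ Φ.upperFlag m ↔ ∀ j : Fin (d + 1), (j : ℕ) < m → Φ.E j v = 0 := by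
  simp [upperFlag, Submodule.mem_iInf]

variable (Φ) in
theorem lowerFlag_mono : Monotone Φ.lowerFlag :=
  fun _ _ hmn _ hv => mem_lowerFlag.2 fun j hj => mem_lowerFlag.1 hv j (hmn.trans hj)

variable (Φ) in
theorem upperFlag_anti : Antitone Φ.upperFlag :=
  fun _ _ hmn _ hv => mem_upperFlag.2 fun j hj => mem_upperFlag.1 hv j (hj.trans_le hmn)

variable (Φ) in
theorem lowerFlag_zero : Φ.lowerFlag 0 = ⊥ := by
  refine (Submodule.eq_bot_iff _).2 fun v hv => ?_
  rw [← Φ.star.sum_E_apply v]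
  exact Finset.sum_eq_zero fun j _ => mem_lowerFlag.1 hv j (Nat.zero_le _)

variable (Φ) in
theorem lowerFlag_of_lt {n : ℕ} (h : d < n) : Φ.lowerFlag n = ⊤ :=
  eq_top_iff.2 fun _ _ => mem_lowerFlag.2 fun j hj => by lia

variable (Φ) in
theorem upperFlag_zero : Φ.upperFlag 0 = ⊤ :=
  eq_top_iff.2 fun _ _ => mem_upperFlag.2 fun j hj => by lia

variable (Φ) in
theorem lowerFlag_ne_top {n : ℕ} (hn : n ≤ d) : Φ.lowerFlag n ≠ ⊤ := by
  obtain ⟨v, hv⟩ := Φ.star.exists_E_apply_ne_zero (Fin.last d)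
  exact fun h => hv (mem_lowerFlag.1 (h ▸ Submodule.mem_top) (Fin.last d) hn)

variable (Φ) in
theorem upperFlag_one_ne_top : Φ.upperFlag 1 ≠ ⊤ := by
  obtain ⟨v, hv⟩ := Φ.exists_E_apply_ne_zero 0
  exact fun h => hv (mem_upperFlag.1 (h ▸ Submodule.mem_top) 0 (by simp))

theorem mem_lowerFlag_one : v ∈ Φ.lowerFlag 1 ↔ v ∈ LinearMap.range (Φ.Es 0) := by
  constructor
  · intro hv
    refine ⟨v, ?_⟩
    conv_rhs => rw [← Φ.star.sum_E_apply v]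
    refine (Finset.sum_eq_single 0 (fun j _ hj => mem_lowerFlag.1 hv j ?_) (by simp)).symm
    exact Nat.one_le_iff_ne_zero.2 fun h => hj (Fin.ext h)
  · rintro ⟨w, rfl⟩
    exact mem_lowerFlag.2 fun j hj => LinearMap.congr_fun
      (Φ.star.E_mul_E_of_ne (i := j) (j := 0) (by rintro rfl; simp at hj)) w

variable (Φ) in
theorem lowerFlag_one_ne_bot : Φ.lowerFlag 1 ≠ ⊥ := by
  obtain ⟨v, hv⟩ := Φ.star.exists_E_apply_ne_zero 0
  exact (Submodule.ne_bot_iff _).2 ⟨_, mem_lowerFlag_one.2 ⟨v, rfl⟩, hv⟩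

theorem mem_upperFlag_one : v ∈ Φ.upperFlag 1 ↔ Φ.E 0 v = 0 :=
  mem_upperFlag.trans ⟨fun h => h 0 (by simp), fun h j hj => by
    rwa [show j = 0 from Fin.ext (by simpa using hj)]⟩

theorem mem_ddown_upperFlag {m : ℕ} :
    v ∈ Φ.ddown.upperFlag m ↔ ∀ j : Fin (d + 1), d < j + m → Φ.E j v = 0 := by
  refine mem_upperFlag.trans ⟨fun h j hj => ?_, fun h j hj => h j.rev (by rw [Fin.val_rev]; lia)⟩
  simpa [ddown] using h j.rev (by rw [Fin.val_rev]; lia)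

theorem A_sub_smul_mem_upperFlag {m : ℕ} (hv : v ∈ Φ.upperFlag m) :
    Φ.A v - Φ.theta m • v ∈ Φ.upperFlag (m + 1) := by
  refine mem_upperFlag.2 fun j hj => ?_
  rw [map_sub, map_smul, E_A_apply, ← sub_smul]
  obtain h | h := Nat.lt_succ_iff_lt_or_eq.1 hj
  · rw [mem_upperFlag.1 hv j h, smul_zero]
  · rw [h, sub_self, zero_smul]

theorem As_sub_smul_mem_lowerFlag {n : ℕ} (hv : v ∈ Φ.lowerFlag (n + 1)) :
    Φ.As v - Φ.thetas n • v ∈ Φ.lowerFlag n := by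
  refine mem_lowerFlag.2 fun j hj => ?_
  rw [map_sub, map_smul, Es_As_apply, ← sub_smul]
  obtain h | h := hj.lt_or_eq
  · rw [mem_lowerFlag.1 hv j h, smul_zero]
  · rw [h, sub_self, zero_smul]

theorem As_mem_lowerFlag {n : ℕ} (hv : v ∈ Φ.lowerFlag n) : Φ.As v ∈ Φ.lowerFlag n :=
  mem_lowerFlag.2 fun j hj => by rw [Es_As_apply, mem_lowerFlag.1 hv j hj, smul_zero]

theorem As_mem_upperFlag {m : ℕ} (hv : v ∈ Φ.upperFlag (m + 1)) : Φ.As v ∈ Φ.upperFlag m := by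
  refine mem_upperFlag.2 fun j hj => ?_
  rw [← Φ.sum_E_apply v, map_sum, map_sum]
  refine Finset.sum_eq_zero fun k _ => ?_
  by_cases hk : (k : ℕ) < m + 1
  · rw [mem_upperFlag.1 hv k hk, map_zero, map_zero]
  · exact Φ.E_As_E_apply_eq_zero (by lia) v

theorem A_mem_lowerFlag {n : ℕ} (hv : v ∈ Φ.lowerFlag n) : Φ.A v ∈ Φ.lowerFlag (n + 1) := by
  refine mem_lowerFlag.2 fun j hj => ?_
  rw [← Φ.star.sum_E_apply v, map_sum, map_sum]
  refine Finset.sum_eq_zero fun k _ => ?_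
  by_cases hk : n ≤ (k : ℕ)
  · rw [show Φ.star.E k v = 0 from mem_lowerFlag.1 hv k hk, map_zero, map_zero]
  · exact Φ.star.E_As_E_apply_eq_zero (by lia) v

theorem A_sub_smul_mem_splitComponent {k n : ℕ} (hv : v ∈ Φ.splitComponent k n) :
    Φ.A v - Φ.theta n • v ∈ Φ.splitComponent k (n + 1) := by
  refine ⟨?_, A_sub_smul_mem_upperFlag hv.2⟩
  rw [add_right_comm]
  exact sub_mem (A_mem_lowerFlag hv.1)
    (Submodule.smul_mem _ _ (Φ.lowerFlag_mono (Nat.le_succ _) hv.1))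

theorem As_sub_smul_mem_splitComponent {k n : ℕ} (hv : v ∈ Φ.splitComponent k (n + 1)) :
    Φ.As v - Φ.thetas (n + k) • v ∈ Φ.splitComponent k n :=
  ⟨As_sub_smul_mem_lowerFlag (add_right_comm n 1 k ▸ hv.1),
    sub_mem (As_mem_upperFlag hv.2) (Submodule.smul_mem _ _ (Φ.upperFlag_anti n.le_succ hv.2))⟩

theorem As_mem_splitComponent_zero {k : ℕ} (hv : v ∈ Φ.splitComponent k 0) :
    Φ.As v ∈ Φ.splitComponent k 0 :=
  ⟨As_mem_lowerFlag hv.1, by simp [upperFlag_zero]⟩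

variable (Φ) in
theorem iSup_eq_bot_or_top_of_raise_lower {W : ℕ → Submodule F V} (s s' : ℕ → F)
    (hA : ∀ n, ∀ v ∈ W n, Φ.A v - s n • v ∈ W (n + 1)) (hAs₀ : ∀ v ∈ W 0, Φ.As v ∈ W 0)
    (hAs : ∀ n, ∀ v ∈ W (n + 1), Φ.As v - s' n • v ∈ W n) :
    ⨆ n, W n = ⊥ ∨ ⨆ n, W n = ⊤ := by
  have hWA : (⨆ n, W n).map Φ.A ≤ ⨆ n, W n := by
    rw [Submodule.map_iSup]
    refine iSup_le fun n => ?_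
    rintro _ ⟨v, hv, rfl⟩
    rw [← sub_add_cancel (Φ.A v) (s n • v)]
    exact add_mem (Submodule.mem_iSup_of_mem (n + 1) (hA n v hv))
      (Submodule.mem_iSup_of_mem n (Submodule.smul_mem _ _ hv))
  have hWAs : (⨆ n, W n).map Φ.As ≤ ⨆ n, W n := by
    rw [Submodule.map_iSup]
    refine iSup_le fun n => ?_
    rintro _ ⟨v, hv, rfl⟩
    rcases n with _ | n
    · exact Submodule.mem_iSup_of_mem 0 (hAs₀ v hv)
    rw [← sub_add_cancel (Φ.As v) (s' n • v)]
    exact add_mem (Submodule.mem_iSup_of_mem n (hAs n v hv))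
      (Submodule.mem_iSup_of_mem (n + 1) (Submodule.smul_mem _ _ hv))
  by_contra! h
  exact Φ.isPair.irreducible ⟨_, hWA, hWAs, h.1, h.2⟩

variable (Φ) in
theorem splitComponent_zero_eq_bot (n : ℕ) : Φ.splitComponent 0 n = ⊥ := by
  have h0 : Φ.splitComponent 0 0 = ⊥ := by simp [splitComponent, lowerFlag_zero]
  obtain h | h := Φ.iSup_eq_bot_or_top_of_raise_lower (W := Φ.splitComponent 0) Φ.theta Φ.thetas
    (fun _ _ => A_sub_smul_mem_splitComponent) (fun _ => As_mem_splitComponent_zero)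
    (fun _ _ => As_sub_smul_mem_splitComponent)
  · exact eq_bot_iff.2 (h ▸ le_iSup (Φ.splitComponent 0) n)
  · refine absurd (top_le_iff.1 (h ▸ iSup_le fun n => ?_)) Φ.upperFlag_one_ne_top
    rcases n with _ | n
    · exact h0 ▸ bot_le
    · exact inf_le_right.trans (Φ.upperFlag_anti (by lia))

theorem eq_zero_of_mem_lowerFlag_of_mem_upperFlag {n m : ℕ} (hnm : n ≤ m)
    (hlow : v ∈ Φ.lowerFlag n) (hup : v ∈ Φ.upperFlag m) : v = 0 := by
  have hv : v ∈ Φ.splitComponent 0 n := ⟨hlow, Φ.upperFlag_anti hnm hup⟩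
  simpa [splitComponent_zero_eq_bot] using hv

theorem mem_splitComponent_one_zero :
    v ∈ Φ.splitComponent 1 0 ↔ v ∈ LinearMap.range (Φ.Es 0) := by
  simp [splitComponent, upperFlag_zero, mem_lowerFlag_one]

variable (Φ) in
theorem splitComponent_one_ne_bot {i : ℕ} (hi : i ≤ d) : Φ.splitComponent 1 i ≠ ⊥ := by
  intro hbot
  have hU₀ : Φ.splitComponent 1 0 = Φ.lowerFlag 1 := by simp [splitComponent, upperFlag_zero]
  have hpos : 0 < i := Nat.pos_of_ne_zero fun h =>
    Φ.lowerFlag_one_ne_bot (by rw [← hU₀, ← h, hbot])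
  -- If `Uᵢ = 0`, the sum `U₀ + ⋯ + U_{i-1}` is invariant under `A` and `A*`.
  let W : ℕ → Submodule F V := fun n => if n < i then Φ.splitComponent 1 n else ⊥
  have hle : ∀ n, W n ≤ Φ.splitComponent 1 n := fun n => by
    by_cases hn : n < i <;> simp [W, hn]
  have hge : ∀ n ≤ i, Φ.splitComponent 1 n ≤ W n := fun n hn => by
    obtain hn | rfl := hn.lt_or_eq
    · simp [W, hn]
    · exact hbot ▸ bot_le
  have hzero : ∀ n, i ≤ n → ∀ v ∈ W n, v = 0 := fun n hn v hv => by
    simpa [W, hn.not_gt] using hv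
  obtain h | h := Φ.iSup_eq_bot_or_top_of_raise_lower (W := W) Φ.theta (fun n => Φ.thetas (n + 1))
    (fun n v hv => by
      obtain hn | hn := lt_or_ge n i
      · exact hge _ hn (A_sub_smul_mem_splitComponent (hle n hv))
      · simp [hzero n hn v hv])
    (fun v hv => hge 0 hpos.le (As_mem_splitComponent_zero (hle 0 hv)))
    (fun n v hv => by
      obtain hn | hn := lt_or_ge (n + 1) i
      · exact hge _ (by lia) (As_sub_smul_mem_splitComponent (hle _ hv))
      · simp [hzero _ hn v hv])
  · refine Φ.lowerFlag_one_ne_bot (eq_bot_iff.2 (h ▸ le_trans ?_ (le_iSup W 0)))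
    exact hU₀ ▸ hge 0 hpos.le
  · refine Φ.lowerFlag_ne_top hi (top_le_iff.1 (h ▸ iSup_le fun n => ?_))
    obtain hn | hn := lt_or_ge n i
    · exact (hle n).trans (inf_le_left.trans (Φ.lowerFlag_mono hn))
    · exact fun v hv => hzero n hn v hv ▸ zero_mem _

theorem pow_A_mem_lowerFlag {n : ℕ} (hv : v ∈ Φ.lowerFlag n) (k : ℕ) :
    (Φ.A ^ k) v ∈ Φ.lowerFlag (n + k) := by
  induction k with
  | zero => simpa using hv
  | succ k ih => exact pow_succ' Φ.A k ▸ A_mem_lowerFlag ih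

theorem pow_As_mem_upperFlag {m k : ℕ} (hv : v ∈ Φ.upperFlag (m + k)) :
    (Φ.As ^ k) v ∈ Φ.upperFlag m := by
  induction k generalizing m with
  | zero => simpa using hv
  | succ k ih =>
    exact pow_succ' Φ.As k ▸ As_mem_upperFlag (ih (by rwa [add_right_comm, add_assoc]))

theorem aeval_A_mem_lowerFlag {f : F[X]} {n k : ℕ} (hf : f.degree < k)
    (hv : v ∈ Φ.lowerFlag (n + 1)) : aeval Φ.A f v ∈ Φ.lowerFlag (n + k) := by
  rw [aeval_eq_sum_range, LinearMap.sum_apply]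
  refine sum_mem fun j _ => ?_
  obtain hjk | hkj := lt_or_ge j k
  · exact Submodule.smul_mem _ _ (Φ.lowerFlag_mono (by lia) (pow_A_mem_lowerFlag hv j))
  · simp [coeff_eq_zero_of_degree_lt (hf.trans_le (by exact_mod_cast hkj))]

theorem aeval_As_mem_upperFlag {f : F[X]} {m k : ℕ} (hf : f.degree < k)
    (hv : v ∈ Φ.upperFlag (m + k)) : aeval Φ.As f v ∈ Φ.upperFlag (m + 1) := by
  rw [aeval_eq_sum_range, LinearMap.sum_apply]
  refine sum_mem fun j _ => ?_
  obtain hjk | hkj := lt_or_ge j k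
  · exact Submodule.smul_mem _ _ (pow_As_mem_upperFlag (Φ.upperFlag_anti (by lia) hv))
  · simp [coeff_eq_zero_of_degree_lt (hf.trans_le (by exact_mod_cast hkj))]

theorem aeval_A_nodal_mem_splitComponent {k m : ℕ} (hv : v ∈ Φ.splitComponent k m) (i : ℕ) :
    aeval Φ.A (nodal (Finset.range i) fun h => Φ.theta (m + h)) v ∈
      Φ.splitComponent k (m + i) := by
  induction i with
  | zero => simpa using hv
  | succ i ih => exact aeval_nodal_range_succ' Φ.A _ i v ▸ A_sub_smul_mem_splitComponent ih

theorem aeval_As_nodal_mem_lowerFlag {n i : ℕ} (hv : v ∈ Φ.lowerFlag (n + i)) :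
    aeval Φ.As (nodal (Finset.range i) fun h => Φ.thetas (n + h)) v ∈ Φ.lowerFlag n := by
  induction i generalizing v with
  | zero => simpa using hv
  | succ i ih =>
    rw [aeval_nodal_range_succ]
    exact ih (As_sub_smul_mem_lowerFlag (by rwa [add_assoc]))

end Flags

end TridiagonalSystem

namespace TridiagonalSystem

variable {F V : Type*} [Field F] [AddCommGroup V] [Module F V] {d : ℕ}
  {Φ : TridiagonalSystem F V d}

section SplitSequence

theorem eq_zero_of_mem_range_Es_zero {v : V} (hv : v ∈ LinearMap.range (Φ.Es 0))
    (h : Φ.E 0 v = 0) : v = 0 :=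
  eq_zero_of_mem_lowerFlag_of_mem_upperFlag le_rfl (mem_lowerFlag_one.2 hv) (mem_upperFlag_one.2 h)

theorem IsSharp.star (h : Φ.IsSharp) : Φ.star.IsSharp := by
  let f : LinearMap.range (Φ.Es 0) →ₗ[F] LinearMap.range (Φ.E 0) :=
    (Φ.E 0).rangeRestrict ∘ₗ (LinearMap.range (Φ.Es 0)).subtype
  have hf : Function.Injective f := (injective_iff_map_eq_zero f).2 fun v hv =>
    Subtype.ext (eq_zero_of_mem_range_Es_zero v.2 (congrArg Subtype.val hv))
  have : Module.Finite F (LinearMap.range (Φ.E 0)) := Module.finite_of_finrank_eq_succ h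
  have : Module.Finite F (LinearMap.range (Φ.star.E 0)) := Module.Finite.of_injective f hf
  refine le_antisymm ((LinearMap.finrank_le_finrank_of_injective hf).trans_eq h) ?_
  refine Nat.one_le_iff_ne_zero.2 fun h0 => Φ.star.E_ne_zero 0 ?_
  exact LinearMap.range_eq_bot.1 (Submodule.finrank_eq_zero.1 h0)

theorem IsSharp.ddown (h : Φ.IsSharp) : Φ.ddown.IsSharp :=
  IsSharp.star (Φ := Φ.star.down) h.star

theorem IsSharp.exists_generator (h : Φ.IsSharp) :
    ∃ e ∈ LinearMap.range (Φ.Es 0), e ≠ 0 ∧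
      ∀ v ∈ LinearMap.range (Φ.Es 0), ∃ c : F, v = c • e := by
  obtain ⟨e, he, hspan⟩ := finrank_eq_one_iff'.1 h.star
  refine ⟨e, e.2, fun h0 => he (Subtype.ext h0), fun v hv => ?_⟩
  obtain ⟨c, hc⟩ := hspan ⟨v, hv⟩
  exact ⟨c, (congrArg Subtype.val hc).symm⟩

theorem splitMap_apply (i : ℕ) (v : V) : Φ.splitMap i v =
    aeval Φ.As (nodal (Finset.range i) fun h => Φ.thetas (h + 1))
      (aeval Φ.A (nodal (Finset.range i) Φ.theta) v) :=
  rfl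

theorem aeval_A_nodal_theta_mem_splitComponent {v : V} (hv : v ∈ LinearMap.range (Φ.Es 0))
    (i : ℕ) : aeval Φ.A (nodal (Finset.range i) Φ.theta) v ∈ Φ.splitComponent 1 i := by
  simpa using aeval_A_nodal_mem_splitComponent (mem_splitComponent_one_zero.2 hv) i

theorem splitMap_mem {v : V} (hv : v ∈ LinearMap.range (Φ.Es 0)) (i : ℕ) :
    Φ.splitMap i v ∈ LinearMap.range (Φ.Es 0) := by
  rw [← mem_lowerFlag_one, splitMap_apply]
  simp only [add_comm _ 1]
  exact aeval_As_nodal_mem_lowerFlag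
    (add_comm i 1 ▸ (aeval_A_nodal_theta_mem_splitComponent hv i).1)

theorem IsSharp.isSplitValue_zeta (h : Φ.IsSharp) (i : ℕ) : Φ.IsSplitValue i (Φ.zeta i) := by
  have hex : ∃ z : F, Φ.IsSplitValue i z := by
    obtain ⟨e, he, -, hspan⟩ := h.exists_generator
    obtain ⟨z, hz⟩ := hspan _ (splitMap_mem he i)
    refine ⟨z, fun v hv => ?_⟩
    obtain ⟨c, rfl⟩ := hspan v hv
    rw [map_smul, hz, smul_comm]
  rw [zeta, dif_pos hex]
  exact hex.choose_spec

theorem IsSharp.zeta_smul (h : Φ.IsSharp) {e : V} (he : e ∈ LinearMap.range (Φ.Es 0)) (i : ℕ) :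
    Φ.zeta i • e = (∏ h ∈ Finset.range i, (Φ.thetas 0 - Φ.thetas (h + 1))) •
      Φ.Es 0 (aeval Φ.A (nodal (Finset.range i) Φ.theta) e) := by
  have hfix : Φ.Es 0 (Φ.splitMap i e) = Φ.splitMap i e := by
    obtain ⟨w, hw⟩ := splitMap_mem he i
    rw [← hw]
    exact LinearMap.congr_fun (Φ.star.E_mul_E_self 0) w
  rw [← h.isSplitValue_zeta i e he, ← hfix, ← Lagrange.eval_nodal]
  exact Φ.star.E_aeval_A_apply 0 _ _

theorem IsSharp.zeta_eq_sum (h : Φ.IsSharp) {e : V} (he : e ∈ LinearMap.range (Φ.Es 0))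
    (he0 : e ≠ 0) {μ : Fin (d + 1) → F} (hμ : ∀ j, Φ.Es 0 (Φ.E j e) = μ j • e) (i : ℕ) :
    Φ.zeta i = (∏ h ∈ Finset.range i, (Φ.thetas 0 - Φ.thetas (h + 1))) *
      ∑ j, μ j * ∏ h ∈ Finset.range i, (Φ.theta j - Φ.theta h) := by
  apply smul_left_injective F he0
  simp only
  rw [h.zeta_smul he, mul_smul, ← Φ.sum_E_apply (aeval Φ.A _ e), map_sum, Finset.sum_smul]
  congr 1
  refine Finset.sum_congr rfl fun j _ => ?_
  rw [E_aeval_A_apply, map_smul, hμ, smul_smul, Lagrange.eval_nodal, mul_comm]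

theorem IsSharp.exists_common_moments (h : Φ.IsSharp) :
    ∃ μ : Fin (d + 1) → F, ∀ i ≤ d,
      Φ.zeta i = (∏ h ∈ Finset.range i, (Φ.thetas 0 - Φ.thetas (h + 1))) *
        ∑ j, μ j * ∏ h ∈ Finset.range i, (Φ.theta j - Φ.theta h) ∧
      Φ.ddown.zeta i = (∏ h ∈ Finset.range i, (Φ.thetas 0 - Φ.thetas (h + 1))) *
        ∑ j, μ j * ∏ h ∈ Finset.range i, (Φ.theta j - Φ.theta (d - h)) := by
  obtain ⟨e, he, he0, hspan⟩ := h.exists_generator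
  choose μ hμ using fun j => hspan (Φ.Es 0 (Φ.E j e)) (LinearMap.mem_range_self _ _)
  refine ⟨μ, fun i hi => ⟨h.zeta_eq_sum he he0 hμ i, ?_⟩⟩
  rw [h.ddown.zeta_eq_sum (e := e) he he0 (μ := fun j => μ j.rev) (fun j => hμ j.rev) i]
  congr 1
  refine Fintype.sum_equiv Fin.revPerm _ _ fun j => ?_
  rw [Fin.revPerm_apply]
  congr 1
  refine Finset.prod_congr rfl fun h hh => ?_
  have hhi := Finset.mem_range.1 hh
  rw [theta_ddown _ (by lia : (j : ℕ) ≤ d), theta_ddown _ (by lia : h ≤ d), Fin.val_rev,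
    Nat.add_sub_add_right]

theorem IsSharp.E_zero_aeval_As_aeval_A_apply (h : Φ.IsSharp) (i : ℕ) (v : V) :
    Φ.E 0 (aeval Φ.As (nodal (Finset.range i) Φ.thetas)
      (aeval Φ.A (nodal (Finset.range i) fun h => Φ.theta (h + 1)) v)) =
      Φ.star.zeta i • Φ.E 0 v := by
  set s := nodal (Finset.range i) fun h => Φ.theta (h + 1) with hs
  set w := v - Φ.E 0 v
  have hw : w ∈ Φ.splitComponent d 1 := by
    refine ⟨by simp [lowerFlag_of_lt, add_comm 1 d], mem_upperFlag_one.2 ?_⟩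
    rw [map_sub, ← Module.End.mul_apply, E_mul_E_self, sub_self]
  have hcomplement : Φ.E 0 (aeval Φ.As (nodal (Finset.range i) Φ.thetas) (aeval Φ.A s w)) = 0 := by
    have hup := (aeval_A_nodal_mem_splitComponent hw i).2
    simp only [add_comm 1] at hup
    refine mem_upperFlag_one.1
      (aeval_As_mem_upperFlag (m := 0) (k := i + 1) ?_ (by simpa using hup))
    rw [Lagrange.degree_nodal, Finset.card_range]
    exact_mod_cast i.lt_succ_self
  have hline : aeval Φ.A s (Φ.E 0 v) =
      (∏ h ∈ Finset.range i, (Φ.theta 0 - Φ.theta (h + 1))) • Φ.E 0 v := by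
    rw [aeval_A_E_apply, hs, Lagrange.eval_nodal]
    rfl
  rw [map_sub, map_sub, map_sub, hline, sub_eq_zero] at hcomplement
  rw [hcomplement, map_smul, map_smul]
  exact (h.star.zeta_smul (LinearMap.mem_range_self _ _) i).symm

theorem IsSharp.zeta_star (h : Φ.IsSharp) (i : ℕ) : Φ.star.zeta i = Φ.zeta i := by
  obtain ⟨e, he, he0, -⟩ := h.exists_generator
  have hE : Φ.E 0 e ≠ 0 := fun h0 => he0 (eq_zero_of_mem_range_Es_zero he h0)
  set s := nodal (Finset.range i) fun h => Φ.theta (h + 1)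
  set s' := nodal (Finset.range i) fun h => Φ.thetas (h + 1)
  -- Shifting the nodes changes a nodal polynomial by lower degree terms, which the flags kill.
  have hshift : aeval Φ.As (nodal (Finset.range i) Φ.thetas)
      (aeval Φ.A (s - nodal (Finset.range i) Φ.theta) e) = 0 := by
    have hdeg : (s - nodal (Finset.range i) Φ.theta).degree < i := by
      simpa using degree_nodal_sub_nodal_lt (Finset.range i) _ Φ.theta
    have hlow := aeval_A_mem_lowerFlag (n := 0) hdeg (mem_lowerFlag_one.2 he)
    simpa [lowerFlag_zero] using aeval_As_nodal_mem_lowerFlag (n := 0) hlow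
  have hshift' : Φ.E 0 (aeval Φ.As (s' - nodal (Finset.range i) Φ.thetas)
      (aeval Φ.A (nodal (Finset.range i) Φ.theta) e)) = 0 :=
    mem_upperFlag_one.1 (aeval_As_mem_upperFlag (m := 0) (degree_nodal_sub_nodal_lt _ _ _)
      (by simpa using (aeval_A_nodal_theta_mem_splitComponent he i).2))
  rw [map_sub, LinearMap.sub_apply, map_sub, sub_eq_zero] at hshift hshift'
  apply smul_left_injective F hE
  simp only
  rw [← h.E_zero_aeval_As_aeval_A_apply i e, hshift, ← hshift', ← map_smul,
    ← h.isSplitValue_zeta i e he, splitMap_apply]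

end SplitSequence

section CommonRecurrence

/-- `z` satisfies `A²A*A - AA*A² = z(A)A* - A*z(A)`. Its cubic coefficient turns out to be
`(β + 1)⁻¹` for a base `β` of `Φ`. -/
def IsCommutatorPolynomial (Φ : TridiagonalSystem F V d) (z : F[X]) : Prop :=
  ∀ v, Φ.A (Φ.A (Φ.As (Φ.A v))) - Φ.A (Φ.As (Φ.A (Φ.A v))) =
    aeval Φ.A z (Φ.As v) - Φ.As (aeval Φ.A z v)

theorem isCommutatorPolynomial_of_eval_sub_eval {z : F[X]}
    (hz : ∀ i < d, z.eval (Φ.theta i) - z.eval (Φ.theta (i + 1)) =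
      Φ.theta i * Φ.theta (i + 1) * (Φ.theta i - Φ.theta (i + 1))) :
    Φ.IsCommutatorPolynomial z := by
  have hop : Φ.A * (Φ.A * (Φ.As * Φ.A)) - Φ.A * (Φ.As * (Φ.A * Φ.A)) =
      aeval Φ.A z * Φ.As - Φ.As * aeval Φ.A z := by
    refine hom_ext_E Φ fun j k v => ?_
    simp only [LinearMap.sub_apply, Module.End.mul_apply, map_sub, A_E_apply, map_smul, E_A_apply,
      E_aeval_A_apply, aeval_A_E_apply, smul_smul, ← sub_smul]
    by_cases hfar : (j : ℕ) + 1 < k ∨ (k : ℕ) + 1 < j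
    · rw [E_As_E_apply_eq_zero _ hfar, smul_zero, smul_zero]
    congr 1
    have := j.2
    have := k.2
    obtain h | h | h : (j : ℕ) = k ∨ (k : ℕ) = j + 1 ∨ (j : ℕ) = k + 1 := by lia
    · rw [h]
      ring
    · rw [h]
      linear_combination -hz j (by lia)
    · rw [h]
      linear_combination hz k (by lia)
  exact LinearMap.congr_fun hop

theorem Es_aeval_A_apply_of_mem_lowerFlag {l r : ℕ} (hr : l + r < d + 1) {f : F[X]}
    (hf : f.natDegree ≤ r) {v : V} (hv : v ∈ Φ.lowerFlag (l + 1)) :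
    Φ.Es ⟨l + r, hr⟩ (aeval Φ.A f v) = f.coeff r • Φ.Es ⟨l + r, hr⟩ ((Φ.A ^ r) v) := by
  have hdeg : (f - C (f.coeff r) * X ^ r).degree < (r : WithBot ℕ) := by
    refine (degree_lt_iff_coeff_zero _ _).2 fun m hm => ?_
    obtain rfl | hlt := hm.eq_or_lt
    · simp
    · rw [coeff_sub, coeff_C_mul_X_pow, if_neg hlt.ne', coeff_eq_zero_of_natDegree_lt (by lia),
        sub_zero]
  have h := mem_lowerFlag.1 (aeval_A_mem_lowerFlag hdeg hv) ⟨l + r, hr⟩ le_rfl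
  rw [map_sub, LinearMap.sub_apply, map_sub, sub_eq_zero] at h
  rw [h]
  simp [← Algebra.smul_def]

theorem aeval_A_nodal_ne_zero {l r : ℕ} (hlr : 2 * l + r ≤ d) {u : V}
    (hu : u ∈ Φ.lowerFlag (l + 1)) (hu0 : u ≠ 0) :
    aeval Φ.A (nodal (Finset.range r) fun h => Φ.theta (l + h)) u ≠ 0 := by
  refine fun h0 => hu0 (eq_zero_of_mem_lowerFlag_of_mem_upperFlag (Φ := Φ.ddown) (n := l + 1)
    (m := d + 1 - (l + r)) (by lia) hu (mem_ddown_upperFlag.2 fun j hj => ?_))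
  have hj0 := Φ.E_aeval_A_apply j (nodal (Finset.range r) fun h => Φ.theta (l + h)) u
  rw [h0, map_zero, Lagrange.eval_nodal] at hj0
  refine (smul_eq_zero.1 hj0.symm).resolve_left (Finset.prod_ne_zero_iff.2 fun h hh => ?_)
  have hhr := Finset.mem_range.1 hh
  exact sub_ne_zero.2 (Φ.theta_ne (by lia) (by lia) (by lia))

variable (Φ) in
theorem exists_Es_pow_A_apply_ne_zero {l r : ℕ} (hlr : 2 * l + r ≤ d) :
    ∃ v ∈ Φ.lowerFlag (l + 1), Φ.Es ⟨l + r, by lia⟩ ((Φ.A ^ r) v) ≠ 0 := by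
  by_contra! hcon
  obtain ⟨u, hu, hu0⟩ := Submodule.exists_mem_ne_zero_of_ne_bot
    (Φ.splitComponent_one_ne_bot (i := l) (by lia))
  set g := nodal (Finset.range r) fun h => Φ.theta (l + h) with hg
  obtain ⟨hlow, hup⟩ := aeval_A_nodal_mem_splitComponent hu r
  refine aeval_A_nodal_ne_zero hlr hu.1 hu0
    (eq_zero_of_mem_lowerFlag_of_mem_upperFlag le_rfl (mem_lowerFlag.2 fun j hj => ?_) hup)
  obtain h | h := hj.eq_or_lt
  · have htop := Es_aeval_A_apply_of_mem_lowerFlag (by lia) (f := g) (r := r)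
      (by simp [hg, Lagrange.natDegree_nodal]) hu.1
    rw [hcon u hu.1, smul_zero] at htop
    rwa [show j = ⟨l + r, by lia⟩ from Fin.ext h.symm]
  · exact mem_lowerFlag.1 hlow j (by lia)

namespace IsCommutatorPolynomial

variable {z : F[X]}

theorem Es_commutator_apply (hz : Φ.IsCommutatorPolynomial z) {l r : ℕ} (hr : l + r < d + 1)
    (hdeg : z.natDegree ≤ r) {v : V} (hv : v ∈ Φ.lowerFlag (l + 1)) :
    Φ.Es ⟨l + r, hr⟩ (Φ.A (Φ.A (Φ.As (Φ.A v))) - Φ.A (Φ.As (Φ.A (Φ.A v)))) =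
      (z.coeff r * (Φ.thetas l - Φ.thetas (l + r))) • Φ.Es ⟨l + r, hr⟩ ((Φ.A ^ r) v) := by
  have hlow : aeval Φ.A z (Φ.As v - Φ.thetas l • v) ∈ Φ.lowerFlag (l + r) := by
    rw [aeval_eq_sum_range' (Nat.lt_succ_of_le hdeg), LinearMap.sum_apply]
    refine sum_mem fun j hj => Submodule.smul_mem _ _ ?_
    have hjr := Finset.mem_range.1 hj
    exact Φ.lowerFlag_mono (by lia) (pow_A_mem_lowerFlag (As_sub_smul_mem_lowerFlag hv) j)
  have hEs := mem_lowerFlag.1 hlow ⟨l + r, hr⟩ le_rfl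
  rw [map_sub, map_smul, map_sub, map_smul, sub_eq_zero] at hEs
  rw [hz, map_sub, hEs, Es_As_apply, Es_aeval_A_apply_of_mem_lowerFlag hr hdeg hv, ← sub_smul,
    smul_smul, mul_comm]

theorem natDegree_le_three (hz : Φ.IsCommutatorPolynomial z) (hd : z.natDegree ≤ d) :
    z.natDegree ≤ 3 := by
  by_contra! hlt
  obtain ⟨v, hv, hne⟩ := Φ.exists_Es_pow_A_apply_ne_zero (l := 0) (r := z.natDegree) (by lia)
  have hlow : Φ.A (Φ.A (Φ.As (Φ.A v))) - Φ.A (Φ.As (Φ.A (Φ.A v))) ∈ Φ.lowerFlag 4 :=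
    sub_mem (A_mem_lowerFlag (A_mem_lowerFlag (As_mem_lowerFlag (A_mem_lowerFlag hv))))
      (A_mem_lowerFlag (As_mem_lowerFlag (A_mem_lowerFlag (A_mem_lowerFlag hv))))
  have h := hz.Es_commutator_apply (by lia) le_rfl hv
  rw [mem_lowerFlag.1 hlow _ (by simp; lia)] at h
  refine smul_ne_zero (mul_ne_zero ?_ (sub_ne_zero.2 ?_)) hne h.symm
  · exact leadingCoeff_ne_zero.2 fun h0 => by simp [h0] at hlt
  · exact Φ.thetas_ne (by lia) (by lia) (by lia)

theorem thetas_sub_of_two_mul_le (hz : Φ.IsCommutatorPolynomial z) (hdeg : z.natDegree ≤ 3) {l : ℕ}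
    (hl : 2 * l + 3 ≤ d) :
    z.coeff 3 * (Φ.thetas l - Φ.thetas (l + 3)) = Φ.thetas (l + 1) - Φ.thetas (l + 2) := by
  obtain ⟨v, hv, hne⟩ := Φ.exists_Es_pow_A_apply_ne_zero hl
  have hr : l + 3 < d + 1 := by lia
  have hcube : (Φ.A ^ 3) v = Φ.A (Φ.A (Φ.A v)) := rfl
  have hfst : Φ.Es ⟨l + 3, hr⟩ (Φ.A (Φ.A (Φ.As (Φ.A v)))) =
      Φ.thetas (l + 1) • Φ.Es ⟨l + 3, hr⟩ ((Φ.A ^ 3) v) := by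
    have := mem_lowerFlag.1 (A_mem_lowerFlag (A_mem_lowerFlag
      (As_sub_smul_mem_lowerFlag (A_mem_lowerFlag hv)))) ⟨l + 3, hr⟩ le_rfl
    simpa [hcube, sub_eq_zero] using this
  have hsnd : Φ.Es ⟨l + 3, hr⟩ (Φ.A (Φ.As (Φ.A (Φ.A v)))) =
      Φ.thetas (l + 2) • Φ.Es ⟨l + 3, hr⟩ ((Φ.A ^ 3) v) := by
    have := mem_lowerFlag.1 (A_mem_lowerFlag (As_sub_smul_mem_lowerFlag
      (A_mem_lowerFlag (A_mem_lowerFlag hv)))) ⟨l + 3, hr⟩ le_rfl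
    simpa [hcube, sub_eq_zero] using this
  have h := hz.Es_commutator_apply hr hdeg hv
  rw [map_sub, hfst, hsnd, ← sub_smul] at h
  exact (smul_left_injective F hne h).symm

theorem thetas_sub (hz : Φ.IsCommutatorPolynomial z) (hdeg : z.natDegree ≤ 3) {l : ℕ}
    (hl : l + 3 ≤ d) :
    z.coeff 3 * (Φ.thetas l - Φ.thetas (l + 3)) = Φ.thetas (l + 1) - Φ.thetas (l + 2) := by
  by_cases h : 2 * l + 3 ≤ d
  · exact hz.thetas_sub_of_two_mul_le hdeg h
  · obtain ⟨m, hm⟩ : ∃ m, d = l + 3 + m := ⟨d - (l + 3), by lia⟩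
    have hdown := thetas_sub_of_two_mul_le (Φ := Φ.down) hz hdeg (l := m) (by lia)
    rw [thetas_down _ (by lia), thetas_down _ (by lia), thetas_down _ (by lia),
      thetas_down _ (by lia), show d - (m + 1) = l + 2 by lia, show d - (m + 2) = l + 1 by lia,
      show d - m = l + 3 by lia, show d - (m + 3) = l by lia] at hdown
    linear_combination -hdown

end IsCommutatorPolynomial

variable (Φ) in
theorem exists_isBase : ∃ β : F, Φ.IsBase β := by
  by_cases hd : 3 ≤ d
  swap
  · exact ⟨1, by simp [IsBase, hd]⟩
  obtain ⟨z, hzd, hstep⟩ := exists_natDegree_le_eval_sub_eval_succ Φ.theta_injOn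
    fun i => Φ.theta i * Φ.theta (i + 1) * (Φ.theta i - Φ.theta (i + 1))
  have hz := isCommutatorPolynomial_of_eval_sub_eval hstep
  have hdeg := hz.natDegree_le_three hzd
  have htheta : ∀ l, l + 3 ≤ d →
      z.coeff 3 * (Φ.theta l - Φ.theta (l + 3)) = Φ.theta (l + 1) - Φ.theta (l + 2) :=
    fun l hl => coeff_three_mul_sub_of_eval_sub_eval (x := fun i => Φ.theta (l + i)) hdeg
      (fun i hi => hstep (l + i) (by lia)) fun i hi j hj hij => by
        by_contra hne
        exact Φ.theta_ne (by simp at hi; lia) (by simp at hj; lia) (by lia) hij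
  have hz3 : z.coeff 3 ≠ 0 := fun h0 => by
    have h := htheta 0 (by lia)
    rw [h0, zero_mul, eq_comm, sub_eq_zero] at h
    exact Φ.theta_ne (by lia) (by lia) (by lia) h
  refine ⟨(z.coeff 3)⁻¹ - 1, ?_⟩
  rw [IsBase, if_pos hd]
  intro i h2 hi
  obtain ⟨l, rfl⟩ := Nat.exists_eq_add_of_le' h2
  rw [Nat.add_sub_cancel, show l + 2 - 1 = l + 1 by lia, sub_add_cancel,
    div_eq_iff (sub_ne_zero.2 (Φ.theta_ne (by lia) (by lia) (by lia))),
    div_eq_iff (sub_ne_zero.2 (Φ.thetas_ne (by lia) (by lia) (by lia))),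
    eq_inv_mul_iff_mul_eq₀ hz3, eq_inv_mul_iff_mul_eq₀ hz3]
  exact ⟨htheta l (by lia), hz.thetas_sub hdeg (by lia)⟩

end CommonRecurrence

end TridiagonalSystem

section Types

variable {F : Type*} [Field F] {β : F} {d : ℕ}

theorem tdType_eq_I_iff : tdType β d = .I ↔ β ≠ 2 ∧ β ≠ -2 := by
  unfold tdType
  split_ifs <;> grind

theorem eq_two_of_tdType_eq_II (h : tdType β d = .II) : β = 2 ∧ (2 : F) ≠ 0 := by
  unfold tdType at h
  split_ifs at h with hI hchar hβ
  exact ⟨hβ, Ring.two_ne_zero hchar⟩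

theorem eq_neg_two_of_tdType_eq_IIIplus (h : tdType β d = .IIIplus) :
    β = -2 ∧ (2 : F) ≠ 0 ∧ Even d := by
  unfold tdType at h
  split_ifs at h with hI hchar hβ hd
  exact ⟨by tauto, Ring.two_ne_zero hchar, hd⟩

theorem eq_neg_two_of_tdType_eq_IIIminus (h : tdType β d = .IIIminus) :
    β = -2 ∧ (2 : F) ≠ 0 ∧ Odd d := by
  unfold tdType at h
  split_ifs at h with hI hchar hβ hd
  exact ⟨by tauto, Ring.two_ne_zero hchar, Nat.not_even_iff_odd.1 hd⟩

theorem eq_zero_of_tdType_eq_IV (h : tdType β d = .IV) : β = 0 ∧ (2 : F) = 0 := by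
  unfold tdType at h
  split_ifs at h with hI hchar
  have htwo : (2 : F) = 0 := by
    simpa [not_not.1 hchar] using ringChar.Nat.cast_ringChar (R := F)
  have hβ : β = 2 ∨ β = -2 := by tauto
  exact ⟨by obtain rfl | rfl := hβ <;> simp [htwo], htwo⟩

theorem algebraMap_algebraicClosure_two : algebraMap F (AlgebraicClosure F) 2 = 2 :=
  map_ofNat _ 2

theorem algebraicClosure_two_ne_zero (h : (2 : F) ≠ 0) : (2 : AlgebraicClosure F) ≠ 0 := by
  rw [← algebraMap_algebraicClosure_two]
  exact (_root_.map_ne_zero _).2 h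

theorem algebraicClosure_two_eq_zero (h : (2 : F) = 0) : (2 : AlgebraicClosure F) = 0 := by
  rw [← algebraMap_algebraicClosure_two, h, map_zero]

end Types

section Recurrences

theorem eq_of_recurrence {R : Type*} [Ring R] {f g : ℕ → R} {r : R} {d : ℕ}
    (hf : ∀ i, i + 3 ≤ d → f i - f (i + 3) = r * (f (i + 1) - f (i + 2)))
    (hg : ∀ i, i + 3 ≤ d → g i - g (i + 3) = r * (g (i + 1) - g (i + 2)))
    (h0 : f 0 = g 0) (h1 : f 1 = g 1) (h2 : f 2 = g 2) {i : ℕ} (hi : i ≤ d) : f i = g i := by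
  induction i using Nat.strong_induction_on with
  | _ i ih =>
    match i with
    | 0 => exact h0
    | 1 => exact h1
    | 2 => exact h2
    | i + 3 =>
      have h := hf i hi
      rw [ih i (by lia) (by lia), ih (i + 1) (by lia) (by lia), ih (i + 2) (by lia) (by lia),
        ← hg i hi] at h
      exact sub_right_injective h

variable {K : Type*} [Field K] {q b : K} {d : ℕ} {f : ℕ → K}

theorem zpow_two_mul_sub (hq : q ≠ 0) (i d : ℕ) :
    q ^ (2 * (i : ℤ) - d) = (q ^ i) ^ 2 / q ^ d := by
  rw [zpow_sub₀ hq, mul_comm 2, zpow_mul]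
  norm_cast

theorem zpow_sub_two_mul (hq : q ≠ 0) (i d : ℕ) :
    q ^ ((d : ℤ) - 2 * i) = q ^ d / (q ^ i) ^ 2 := by
  rw [zpow_sub₀ hq, mul_comm 2, zpow_mul]
  norm_cast

theorem zpow_two_mul_sub_two_mul (hq : q ≠ 0) (i d : ℕ) :
    q ^ (2 * (i : ℤ) - 2 * d) = (q ^ i) ^ 2 / (q ^ d) ^ 2 := by
  rw [zpow_sub₀ hq, mul_comm 2, mul_comm 2, zpow_mul, zpow_mul]
  norm_cast

theorem exists_sq_add_inv_sq_eq [IsAlgClosed K] (b : K) :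
    ∃ q : K, q ≠ 0 ∧ q ^ 2 + (q⁻¹) ^ 2 = b := by
  obtain ⟨x, hx⟩ := IsAlgClosed.exists_root (C 1 * X ^ 2 + C (-b) * X + C 1 : K[X])
    (by rw [degree_quadratic one_ne_zero]; decide)
  simp only [IsRoot.def, eval_add, eval_mul, eval_C, eval_pow, eval_X] at hx
  obtain ⟨q, rfl⟩ := IsAlgClosed.exists_pow_nat_eq x (n := 2) two_pos
  have hq : q ≠ 0 := by
    rintro rfl
    simp at hx
  refine ⟨q, hq, ?_⟩
  field_simp
  linear_combination hx

theorem sq_sq_ne_one_of_sq_add_inv_sq_eq (h : q ^ 2 + (q⁻¹) ^ 2 = b) (hb : b ≠ 2) (hb' : b ≠ -2) :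
    (q ^ 2) ^ 2 ≠ 1 := by
  intro hone
  obtain hq | hq := sq_eq_one_iff.1 hone
  · exact hb (by rw [← h, inv_pow, hq]; norm_num)
  · exact hb' (by rw [← h, inv_pow, hq]; norm_num)

theorem exists_eq_zpow_of_recurrence (hq : q ≠ 0) (h : q ^ 2 + (q⁻¹) ^ 2 = b) (hb : b ≠ 2)
    (hb' : b ≠ -2) (hf : ∀ i, i + 3 ≤ d → f i - f (i + 3) = (b + 1) * (f (i + 1) - f (i + 2))) :
    ∃ x y z : K, ∀ i ≤ d, f i = x + y * q ^ (2 * (i : ℤ) - d) + z * q ^ ((d : ℤ) - 2 * i) := by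
  have hQ1 := sub_ne_zero.2 (sq_sq_ne_one_of_sq_add_inv_sq_eq h hb hb')
  rw [inv_pow] at h
  set Q := q ^ 2 with hQ
  have hQ0 : Q ≠ 0 := pow_ne_zero 2 hq
  have hd : q ^ d ≠ 0 := pow_ne_zero d hq
  have hQ2 : Q - 1 ≠ 0 := fun h0 => hQ1 (by linear_combination (Q + 1) * h0)
  set y := (f 2 - f 1 - (f 1 - f 0) / Q) * Q / ((Q - 1) * (Q ^ 2 - 1)) with hy
  set z := (f 2 - f 1 - (f 1 - f 0) * Q) * Q ^ 2 / ((Q - 1) * (Q ^ 2 - 1)) with hz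
  have hgeom : ∀ i ≤ d, f i = f 0 - y - z + y * Q ^ i + z * Q⁻¹ ^ i := fun i hi => by
    refine eq_of_recurrence (g := fun i => f 0 - y - z + y * Q ^ i + z * Q⁻¹ ^ i)
      hf (fun i _ => ?_) (by simp only [pow_zero]; ring) ?_ ?_ hi
    · rw [← h]
      simp only [pow_succ, inv_pow]
      field_simp
      ring
    all_goals
      simp only [hy, hz]
      field_simp
      ring
  refine ⟨f 0 - y - z, y * q ^ d, z * (q ^ d)⁻¹, fun i hi => ?_⟩
  rw [zpow_two_mul_sub hq, zpow_sub_two_mul hq, pow_right_comm, ← hQ, hgeom i hi, inv_pow]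
  field_simp

theorem exists_eq_quadratic_of_recurrence (h2 : (2 : K) ≠ 0)
    (hf : ∀ i, i + 3 ≤ d → f i - f (i + 3) = (2 + 1) * (f (i + 1) - f (i + 2))) :
    ∃ a b c : K, ∀ i ≤ d, f i = a + b * (i - d / 2) + c * i * (d - i) := by
  set c := -(f 2 - 2 * f 1 + f 0) / 2 with hc
  set b := f 1 - f 0 - c * (d - 1) with hb
  refine ⟨f 0 + b * d / 2, b, c, fun i hi => eq_of_recurrence
    (g := fun i : ℕ => f 0 + b * d / 2 + b * (i - d / 2) + c * i * (d - i)) hf (fun i _ => ?_)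
    (by simp; ring) ?_ ?_ hi⟩
  · push_cast
    ring
  all_goals
    simp only [hb, hc]
    push_cast
    field_simp
    ring

theorem exists_eq_alternating_of_recurrence (h2 : (2 : K) ≠ 0)
    (hf : ∀ i, i + 3 ≤ d → f i - f (i + 3) = (-2 + 1) * (f (i + 1) - f (i + 2))) :
    ∃ a b c : K, ∀ i ≤ d, f i = if Even i then a + b + c * (i - d / 2)
      else a - b - c * (i - d / 2) := by
  set c := (f 2 - f 0) / 2 with hc
  set a := (f 0 + f 1 + c) / 2 with ha
  set b := f 0 - a + c * d / 2 with hb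
  refine ⟨a, b, c, fun i hi => eq_of_recurrence
    (g := fun i : ℕ => if Even i then a + b + c * (i - d / 2) else a - b - c * (i - d / 2))
      hf (fun i _ => ?_) ?_ ?_ ?_ hi⟩
  · by_cases he : Even i <;>
    · simp only [he, Nat.not_even_one, Nat.even_add, not_true_eq_false, if_true, if_false,
        show ¬ Even 3 by decide, even_two, iff_true, iff_false]
      push_cast
      ring
  all_goals
    simp [hb, ha, hc]
    field_simp
    ring

end Recurrences

namespace TridiagonalSystem

variable {F V : Type*} [Field F] [AddCommGroup V] [Module F V] {d : ℕ}
  {Φ : TridiagonalSystem F V d} {β : F}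

theorem IsBase.recurrence (h : Φ.IsBase β) {i : ℕ} (hi : i + 3 ≤ d) :
    Φ.theta i - Φ.theta (i + 3) = (β + 1) * (Φ.theta (i + 1) - Φ.theta (i + 2)) ∧
      Φ.thetas i - Φ.thetas (i + 3) = (β + 1) * (Φ.thetas (i + 1) - Φ.thetas (i + 2)) := by
  rw [IsBase, if_pos (by lia)] at h
  have := h (i + 2) (by lia) (by lia)
  rwa [Nat.add_sub_cancel, show i + 2 - 1 = i + 1 by lia,
    div_eq_iff (sub_ne_zero.2 (Φ.theta_ne (by lia) (by lia) (by lia))),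
    div_eq_iff (sub_ne_zero.2 (Φ.thetas_ne (by lia) (by lia) (by lia)))] at this

theorem IsBase.diameter_eq_three (h : Φ.IsBase (0 : F)) : d = 3 := by
  have h3 : 3 ≤ d := by
    by_contra h3
    simp [IsBase, h3] at h
  by_contra hne
  have hfst := (h.recurrence (i := 0) (by lia)).1
  have hsnd := (h.recurrence (i := 1) (by lia)).1
  simp only [zero_add, Nat.reduceAdd] at hfst hsnd
  refine Φ.theta_ne (i := 0) (j := 4) (by lia) (by lia) (by lia) ?_
  linear_combination hfst + hsnd

/-- The scalars `a, b, c, a*, b*, c*` of `F`, viewed in the algebraic closure; `q` is set to `0`,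
since only type I uses it. -/
noncomputable def rationalScalars (a b c as bs cs : F) : TDScalars (AlgebraicClosure F) :=
  ⟨0, algebraMap F _ a, algebraMap F _ b, algebraMap F _ c, algebraMap F _ as, algebraMap F _ bs,
    algebraMap F _ cs⟩

theorem isRational_rationalScalars (a b c as bs cs : F) :
    (rationalScalars a b c as bs cs).IsRational := by
  simp [TDScalars.IsRational, rationalScalars]

theorem IsBase.exists_isScalars_I (h : Φ.IsBase β) (ht : tdType β d = .I) :
    ∃ e : TDScalars (AlgebraicClosure F), Φ.IsScalars β e := by
  set ι := algebraMap F (AlgebraicClosure F) with hι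
  obtain ⟨h2, h2'⟩ := tdType_eq_I_iff.1 ht
  have hβ2 : ι β ≠ 2 := fun hβ => h2 (ι.injective (by rw [hβ, algebraMap_algebraicClosure_two]))
  have hβ2' : ι β ≠ -2 := fun hβ =>
    h2' (ι.injective (by rw [hβ, map_neg, algebraMap_algebraicClosure_two]))
  obtain ⟨q, hq, hqβ⟩ := exists_sq_add_inv_sq_eq (ι β)
  obtain ⟨a, b, c, hθ⟩ := exists_eq_zpow_of_recurrence hq hqβ hβ2 hβ2' (f := Φ.thetaBar) (d := d)
    fun i hi => by simpa [thetaBar, ← hι] using congrArg ι (h.recurrence hi).1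
  obtain ⟨as, bs, cs, hθs⟩ := exists_eq_zpow_of_recurrence hq hqβ hβ2 hβ2' (f := Φ.thetasBar)
    (d := d) fun i hi => by simpa [thetasBar, ← hι] using congrArg ι (h.recurrence hi).2
  refine ⟨⟨q, a, b, c, as, bs, cs⟩, ?_⟩
  simp only [IsScalars, ht]
  exact ⟨hq, hqβ, fun i hi => ⟨hθ i hi, hθs i hi⟩⟩

theorem IsBase.exists_isScalars_II (h : Φ.IsBase β) (ht : tdType β d = .II) :
    ∃ e : TDScalars (AlgebraicClosure F), Φ.IsScalars β e := by
  obtain ⟨rfl, h2⟩ := eq_two_of_tdType_eq_II ht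
  obtain ⟨a, b, c, hθ⟩ := exists_eq_quadratic_of_recurrence h2 fun i hi => (h.recurrence hi).1
  obtain ⟨as, bs, cs, hθs⟩ := exists_eq_quadratic_of_recurrence h2 fun i hi => (h.recurrence hi).2
  refine ⟨rationalScalars a b c as bs cs, ?_⟩
  simp only [IsScalars, ht]
  exact ⟨isRational_rationalScalars _ _ _ _ _ _, fun i hi =>
    ⟨by simp [thetaBar, hθ i hi, rationalScalars, algebraMap_algebraicClosure_two],
      by simp [thetasBar, hθs i hi, rationalScalars, algebraMap_algebraicClosure_two]⟩⟩

theorem IsBase.exists_isScalars_III (h : Φ.IsBase β)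
    (ht : tdType β d = .IIIplus ∨ tdType β d = .IIIminus) :
    ∃ e : TDScalars (AlgebraicClosure F), Φ.IsScalars β e := by
  obtain ⟨rfl, h2⟩ : β = -2 ∧ (2 : F) ≠ 0 := by
    obtain ht | ht := ht
    · exact (eq_neg_two_of_tdType_eq_IIIplus ht).imp_right And.left
    · exact (eq_neg_two_of_tdType_eq_IIIminus ht).imp_right And.left
  obtain ⟨a, b, c, hθ⟩ := exists_eq_alternating_of_recurrence h2 fun i hi => (h.recurrence hi).1
  obtain ⟨as, bs, cs, hθs⟩ := exists_eq_alternating_of_recurrence h2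
    fun i hi => (h.recurrence hi).2
  refine ⟨rationalScalars a b c as bs cs, ?_⟩
  obtain ht | ht := ht <;>
  · simp only [IsScalars, ht]
    refine ⟨isRational_rationalScalars _ _ _ _ _ _, fun i hi => ⟨?_, ?_⟩⟩
    · rw [thetaBar, hθ i hi]
      split_ifs <;> simp [rationalScalars, algebraMap_algebraicClosure_two]
    · rw [thetasBar, hθs i hi]
      split_ifs <;> simp [rationalScalars, algebraMap_algebraicClosure_two]

theorem IsBase.exists_isScalars_IV (h : Φ.IsBase β) (ht : tdType β d = .IV) :
    ∃ e : TDScalars (AlgebraicClosure F), Φ.IsScalars β e := by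
  obtain ⟨rfl, h2⟩ := eq_zero_of_tdType_eq_IV ht
  obtain rfl := h.diameter_eq_three
  obtain ⟨hθ, hθs⟩ := h.recurrence (i := 0) le_rfl
  refine ⟨rationalScalars (Φ.theta 0) (Φ.theta 3) (Φ.theta 2 - Φ.theta 0) (Φ.thetas 0)
    (Φ.thetas 3) (Φ.thetas 2 - Φ.thetas 0), ?_⟩
  simp only [IsScalars, ht]
  refine ⟨trivial, isRational_rationalScalars _ _ _ _ _ _, ?_⟩
  simp only [rationalScalars, thetaBar, thetasBar, ← map_add, add_sub_cancel, true_and, and_true]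
  constructor <;> congr 1
  · linear_combination hθ + h2 * (Φ.theta 1 - Φ.theta 2)
  · linear_combination hθs + h2 * (Φ.thetas 1 - Φ.thetas 2)

theorem IsBase.exists_isScalars (h : Φ.IsBase β) :
    ∃ e : TDScalars (AlgebraicClosure F), Φ.IsScalars β e := by
  cases ht : tdType β d with
  | I => exact h.exists_isScalars_I ht
  | II => exact h.exists_isScalars_II ht
  | IIIplus => exact h.exists_isScalars_III (.inl ht)
  | IIIminus => exact h.exists_isScalars_III (.inr ht)
  | IV => exact h.exists_isScalars_IV ht

end TridiagonalSystem

section DividedDifferences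

variable {R : Type*} [CommRing R] {x : ℕ → R} {d : ℕ} {D : ℕ → ℕ → R}

/-- `D` is a table of divided differences at the nodes `x 0, …, x d`: the entry `D j i` belongs to
the nodes `x j, …, x (j + i)`. The recurrence is written without division, so the nodes need not be
distinct. -/
def IsDividedDifferenceTable (x : ℕ → R) (d : ℕ) (D : ℕ → ℕ → R) : Prop :=
  ∀ j i, j + i + 1 ≤ d → D j (i + 1) * (x (j + i + 1) - x j) = D (j + 1) i - D j i

namespace IsDividedDifferenceTable

theorem sum_mul_prod_sub_add (hD : IsDividedDifferenceTable x d D) (n j : ℕ) (hn : j + n ≤ d) :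
    ∑ i ∈ Finset.range (n + 1), D j i * ∏ k ∈ Finset.range i, (x (j + n) - x (j + k)) =
      D (j + n) 0 := by
  induction n generalizing j with
  | zero => simp
  | succ n ih =>
    have hshift := ih (j + 1) (by lia)
    rw [show j + 1 + n = j + (n + 1) by lia] at hshift
    rw [← hshift, Finset.sum_range_succ']
    set y := x (j + (n + 1)) with hy
    set π : ℕ → R := fun i => ∏ k ∈ Finset.range i, (y - x (j + 1 + k)) with hπ
    have hterm : ∀ i ∈ Finset.range (n + 1), D (j + 1) i * π i =
        (D j i * π i - D j (i + 1) * π (i + 1)) +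
          D j (i + 1) * ∏ k ∈ Finset.range (i + 1), (y - x (j + k)) := fun i hi => by
      have hrec := hD j i (by have := Finset.mem_range.1 hi; lia)
      have hprod : ∏ k ∈ Finset.range i, (y - x (j + (k + 1))) = π i :=
        Finset.prod_congr rfl fun k _ => by rw [add_assoc, add_comm 1]
      have hπ_succ : π (i + 1) = π i * (y - x (j + i + 1)) := by
        simp only [hπ, Finset.prod_range_succ, add_right_comm j 1 i]
      rw [Finset.prod_range_succ', add_zero, hprod, hπ_succ]
      linear_combination (-π i) * hrec
    have hend : π (n + 1) = 0 :=
      Finset.prod_eq_zero (Finset.self_mem_range_succ n)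
        (by rw [hy, add_assoc, add_comm 1, sub_self])
    rw [Finset.sum_congr rfl hterm, Finset.sum_add_distrib, Finset.sum_range_sub', hend]
    simp only [hπ, Finset.prod_range_zero]
    ring

theorem sum_mul_prod_sub (hD : IsDividedDifferenceTable x d D) {m : ℕ} (hm : m ≤ d) :
    ∑ i ∈ Finset.range (d + 1), D 0 i * ∏ k ∈ Finset.range i, (x m - x k) = D m 0 := by
  have h := hD.sum_mul_prod_sub_add m 0 (by lia)
  simp only [zero_add] at h
  rw [← h]
  refine (Finset.sum_subset (Finset.range_mono (by lia)) fun i _ hi => ?_).symm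
  have hmi : m < i := by simpa using hi
  rw [Finset.prod_eq_zero (Finset.mem_range.2 hmi) (sub_self _), mul_zero]

theorem reverse (hD : IsDividedDifferenceTable x d D) :
    IsDividedDifferenceTable (fun j => x (d - j)) d fun j i => D (d - j - i) i := by
  intro j i hji
  obtain ⟨k, rfl⟩ := Nat.exists_eq_add_of_le hji
  have h := hD k i (by lia)
  simp only [show j + i + 1 + k - (j + i + 1) = k by lia,
    show j + i + 1 + k - j = k + i + 1 by lia, show j + i + 1 + k - (j + 1) - i = k by lia,
    show k + i + 1 - i = k + 1 by lia, show k + i + 1 - (i + 1) = k by lia]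
  linear_combination -h

theorem sum_mul_prod_sub_rev (hD : IsDividedDifferenceTable x d D) {m : ℕ} (hm : m ≤ d) :
    ∑ i ∈ Finset.range (d + 1), D (d - i) i * ∏ k ∈ Finset.range i, (x m - x (d - k)) = D m 0 := by
  simpa [Nat.sub_sub_self hm] using hD.reverse.sum_mul_prod_sub (Nat.sub_le d m)

end IsDividedDifferenceTable

end DividedDifferences

section Reversal

variable {K S : Type*} [Field K] [CommRing S] {d i j : ℕ} {f w θ : ℕ → K} {ι : K →+* S}
  {r r' : ℕ → S} {ε : ℕ → ℕ → K}

/-- The identity under which `∏ k < i, f (k + 1)`, as the coefficients of a Newton expansion with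
weights `w s * r s` at the nodes `θ 0, …, θ d`, may be kept on reversing the nodes if `r` is
replaced by `r'`. The factor `ε` accommodates divided differences that vanish. -/
def IsNewtonReversal (d : ℕ) (f w θ : ℕ → K) (ι : K →+* S) (r r' : ℕ → S) (ε : ℕ → ℕ → K) : Prop :=
  ∀ j i, j + i + 1 ≤ d → ι (ε j (i + 1) * f (i + 1) * (θ (j + i + 1) - θ j)) =
    ι (w (i + 1)) * (ι (ε (j + 1) i) * r' (d - j) - ι (ε j i) * r (j + i + 1))

/-- The scalar part of `reversalTable`. It interpolates between the Newton coefficients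
`f 1 ⋯ f i` at `j = 0` and the same coefficients at `j = d - i`. -/
def reversalCoeff (d : ℕ) (f w : ℕ → K) (j i : ℕ) : K :=
  (∏ k ∈ Finset.range i, f (k + 1)) * ∏ s ∈ Finset.range j, (w (i + s + 1) / w (d - s))

theorem reversalCoeff_zero_left (d : ℕ) (f w : ℕ → K) (i : ℕ) :
    reversalCoeff d f w 0 i = ∏ k ∈ Finset.range i, f (k + 1) := by
  simp [reversalCoeff]

theorem reversalCoeff_sub_left (f : ℕ → K) (hw : ∀ i, 1 ≤ i → i ≤ d → w i ≠ 0) (i : ℕ) :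
    reversalCoeff d f w (d - i) i = ∏ k ∈ Finset.range i, f (k + 1) := by
  have hreflect : ∏ s ∈ Finset.range (d - i), w (d - s) =
      ∏ s ∈ Finset.range (d - i), w (i + s + 1) := by
    rw [← Finset.prod_range_reflect]
    refine Finset.prod_congr rfl fun s hs => congrArg w ?_
    have := Finset.mem_range.1 hs
    lia
  have hne : ∏ s ∈ Finset.range (d - i), w (i + s + 1) ≠ 0 :=
    Finset.prod_ne_zero_iff.2 fun s hs => by
      have := Finset.mem_range.1 hs
      exact hw _ (by lia) (by lia)
  rw [reversalCoeff, Finset.prod_div_distrib, hreflect, div_self hne, mul_one]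

theorem reversalCoeff_succ_left_mul (f : ℕ → K) (hw : w (d - j) ≠ 0) :
    reversalCoeff d f w (j + 1) i * w (d - j) = reversalCoeff d f w j i * w (j + i + 1) := by
  rw [reversalCoeff, reversalCoeff, Finset.prod_range_succ, add_comm j i]
  field_simp

theorem reversalCoeff_succ_right_mul (d : ℕ) (f w : ℕ → K) (j i : ℕ) :
    reversalCoeff d f w j (i + 1) * w (i + 1) =
      f (i + 1) * (reversalCoeff d f w j i * w (j + i + 1)) := by
  have htelescope : (∏ s ∈ Finset.range j, w (i + 1 + s + 1)) * w (i + 1) =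
      (∏ s ∈ Finset.range j, w (i + s + 1)) * w (j + i + 1) := by
    rw [add_comm j i, ← Finset.prod_range_succ (fun s => w (i + s + 1)), Finset.prod_range_succ',
      add_zero]
    simp only [add_comm, add_left_comm]
  simp only [reversalCoeff, Finset.prod_div_distrib, Finset.prod_range_succ]
  linear_combination (∏ k ∈ Finset.range i, f (k + 1)) * f (i + 1) *
    (∏ s ∈ Finset.range j, w (d - s))⁻¹ * htelescope

/-- The table of divided differences interpolating between
`f 1 ⋯ f i * ∏ s > i, w s * r s` (the row `j = 0`) and `f 1 ⋯ f i * ∏ s > i, w s * r' s` (the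
antidiagonal `j + i = d`). -/
def reversalTable (d : ℕ) (f w : ℕ → K) (ι : K →+* S) (r r' : ℕ → S) (ε : ℕ → ℕ → K)
    (j i : ℕ) : S :=
  ι (ε j i * reversalCoeff d f w j i) * (∏ s ∈ Finset.Icc (j + i + 1) d, (ι (w s) * r s)) *
    ∏ s ∈ Finset.Icc (d - j + 1) d, (ι (w s) * r' s)

theorem prod_Icc_eq_mul_prod_Icc_succ {M : Type*} [CommMonoid M] (g : ℕ → M) {m n : ℕ}
    (h : m ≤ n) : ∏ s ∈ Finset.Icc m n, g s = g m * ∏ s ∈ Finset.Icc (m + 1) n, g s := by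
  rw [← Finset.insert_Icc_add_one_left_eq_Icc h, Finset.prod_insert (by simp)]

theorem isDividedDifferenceTable_reversalTable (hw : ∀ i, 1 ≤ i → i ≤ d → w i ≠ 0)
    (hr : IsNewtonReversal d f w θ ι r r' ε) :
    IsDividedDifferenceTable (fun i => ι (θ i)) d (reversalTable d f w ι r r' ε) := by
  intro j i hji
  have hleft := congrArg ι (reversalCoeff_succ_left_mul (i := i) f (hw (d - j) (by lia) (by lia)))
  have hright := congrArg ι (reversalCoeff_succ_right_mul d f w j i)
  have hrji := hr j i hji
  have hunit : IsUnit (ι (w (i + 1))) := (hw _ (by lia) (by lia)).isUnit.map ι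
  simp only [reversalTable, map_mul, map_sub] at hleft hright hrji ⊢
  have hcoeff : ι (ε j (i + 1)) * ι (reversalCoeff d f w j (i + 1)) *
        (ι (θ (j + i + 1)) - ι (θ j)) =
      ι (ε (j + 1) i) * ι (reversalCoeff d f w (j + 1) i) * ι (w (d - j)) * r' (d - j) -
        ι (ε j i) * ι (reversalCoeff d f w j i) * ι (w (j + i + 1)) * r (j + i + 1) := by
    refine hunit.mul_left_cancel ?_
    linear_combination ι (ε j (i + 1)) * (ι (θ (j + i + 1)) - ι (θ j)) * hright +
      ι (reversalCoeff d f w j i) * ι (w (j + i + 1)) * hrji -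
      ι (w (i + 1)) * ι (ε (j + 1) i) * r' (d - j) * hleft
  rw [prod_Icc_eq_mul_prod_Icc_succ (fun s => ι (w s) * r s) hji,
    show d - (j + 1) + 1 = d - j by lia,
    prod_Icc_eq_mul_prod_Icc_succ (fun s => ι (w s) * r' s) (Nat.sub_le d j),
    show j + 1 + i + 1 = j + i + 1 + 1 by lia, show j + (i + 1) + 1 = j + i + 1 + 1 by lia]
  linear_combination (∏ s ∈ Finset.Icc (j + i + 1 + 1) d, (ι (w s) * r s)) *
    (∏ s ∈ Finset.Icc (d - j + 1) d, (ι (w s) * r' s)) * hcoeff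

theorem newton_sum_eq_newton_sum_reversed (hw : ∀ i, 1 ≤ i → i ≤ d → w i ≠ 0)
    (hε : ∀ i, ε 0 i = 1) (hε' : ∀ i ≤ d, ε (d - i) i = 1)
    (hr : IsNewtonReversal d f w θ ι r r' ε)
    {m : ℕ} (hm : m ≤ d) :
    ∑ i ∈ Finset.range (d + 1), ι ((∏ k ∈ Finset.range i, f (k + 1)) *
        ∏ k ∈ Finset.range i, (θ m - θ k)) * ∏ s ∈ Finset.Icc (i + 1) d, (ι (w s) * r s) =
      ∑ i ∈ Finset.range (d + 1), ι ((∏ k ∈ Finset.range i, f (k + 1)) *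
        ∏ k ∈ Finset.range i, (θ m - θ (d - k))) *
          ∏ s ∈ Finset.Icc (i + 1) d, (ι (w s) * r' s) := by
  have htable := isDividedDifferenceTable_reversalTable hw hr
  have hsum := (htable.sum_mul_prod_sub hm).trans (htable.sum_mul_prod_sub_rev hm).symm
  convert hsum using 1
  · refine Finset.sum_congr rfl fun i _ => ?_
    simp only [reversalTable, hε, reversalCoeff_zero_left, zero_add, tsub_zero, one_mul, map_mul,
      map_prod, map_sub, Finset.Icc_eq_empty_of_lt (Nat.lt_succ_self d), Finset.prod_empty, mul_one]
    ring
  · refine Finset.sum_congr rfl fun i hi => ?_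
    have hid : i ≤ d := Nat.lt_succ_iff.1 (Finset.mem_range.1 hi)
    simp only [reversalTable, hε' i hid, reversalCoeff_sub_left f hw, Nat.sub_sub_self hid,
      Nat.sub_add_cancel hid, one_mul, map_mul, map_prod, map_sub,
      Finset.Icc_eq_empty_of_lt (Nat.lt_succ_self d), Finset.prod_empty, mul_one]
    ring

end Reversal

namespace TDScalars

variable {F : Type*} [Field F]

/-- The scalar factor split off from `p̂ᵢ` in order to apply `newton_sum_eq_newton_sum_reversed`. -/
noncomputable def weight (β : F) (d : ℕ) (e : TDScalars (AlgebraicClosure F)) (i : ℕ) :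
    AlgebraicClosure F :=
  match tdType β d with
  | .I => (e.q ^ i - (e.q⁻¹) ^ i) ^ 2
  | .II => (i : AlgebraicClosure F) ^ 2
  | .IIIminus => if Even i then (i : AlgebraicClosure F) ^ 2 else 1
  | .IIIplus | .IV => 1

/-- The polynomial `p̂ᵢ` divided by its weight. -/
noncomputable def hatpFactor (β : F) (d : ℕ) (e : TDScalars (AlgebraicClosure F)) (i : ℕ) :
    (AlgebraicClosure F)[X] :=
  match tdType β d with
  | .I => C (e.b * e.bs * e.q ^ (2 * (i : ℤ) - 2 * d) +
      e.c * e.cs * e.q ^ (2 * (d : ℤ) - 2 * i)) - X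
  | .II => C (e.b * e.bs / 2 + (e.b * e.cs + e.c * e.bs) * ((d : AlgebraicClosure F) - i)
          + e.c * e.cs * ((d : AlgebraicClosure F) - i) ^ 2) - X
  | .IIIminus =>
      if Even i then C (e.c * e.cs)
      else
        C (2 * e.b * e.bs + 2 * (e.b * e.cs + e.c * e.bs) * ((i : AlgebraicClosure F) - d)
          + e.c * e.cs * ((i : AlgebraicClosure F) - d) ^ 2) - X
  | .IIIplus | .IV => hatp β d e i

/-- Scalars for `Φ^⇓` obtained from scalars `e` for `Φ`, for every type. -/
noncomputable def reversed (β : F) (d : ℕ) (e : TDScalars (AlgebraicClosure F)) :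
    TDScalars (AlgebraicClosure F) :=
  match tdType β d with
  | .I => e.ddown
  | .II | .IIIminus => ⟨e.q, e.a, -e.b, e.c, e.as, e.bs, e.cs⟩
  | .IIIplus => ⟨e.q, e.a, e.b, -e.c, e.as, e.bs, e.cs⟩
  | .IV => ⟨e.q, e.b, e.a, e.c, e.as, e.bs, e.cs⟩

variable {β : F} {d : ℕ} {e : TDScalars (AlgebraicClosure F)}

theorem hatp_eq (β : F) (d : ℕ) (e : TDScalars (AlgebraicClosure F)) (i : ℕ) :
    hatp β d e i = C (weight β d e i) * hatpFactor β d e i := by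
  cases ht : tdType β d <;> simp only [weight, hatpFactor, hatp, ht, map_one, one_mul]
  split_ifs
  · rw [← C_mul, mul_comm]
  · rw [map_one, one_mul]

theorem weight_reversed (β : F) (d : ℕ) (e : TDScalars (AlgebraicClosure F)) :
    (e.reversed β d).weight β d = e.weight β d := by
  funext i
  cases ht : tdType β d <;> simp only [weight, reversed, ht, TDScalars.ddown]

theorem isRational_iff : e.IsRational ↔ (e.a ∈ (algebraMap F (AlgebraicClosure F)).range ∧
    e.b ∈ (algebraMap F (AlgebraicClosure F)).range ∧
    e.c ∈ (algebraMap F (AlgebraicClosure F)).range) ∧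
    e.as ∈ (algebraMap F (AlgebraicClosure F)).range ∧
    e.bs ∈ (algebraMap F (AlgebraicClosure F)).range ∧
    e.cs ∈ (algebraMap F (AlgebraicClosure F)).range := by
  simp only [IsRational, List.mem_cons, List.not_mem_nil, or_false, forall_eq_or_imp, forall_eq,
    and_assoc]

end TDScalars

/-- The factor `ε` of `IsNewtonReversal` used for tridiagonal systems: for types III⁻ and IV the
divided differences with `j` and `i` both odd vanish. -/
noncomputable def reversalMask {F : Type*} [Field F] (β : F) (d : ℕ) (j i : ℕ) :
    AlgebraicClosure F :=
  match tdType β d with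
  | .I | .II | .IIIplus => 1
  | .IIIminus | .IV => if ¬ Even j ∧ ¬ Even i then 0 else 1

section ReversalMask

variable {F : Type*} [Field F] {β : F} {d : ℕ}

theorem reversalMask_zero_left (i : ℕ) : reversalMask β d 0 i = 1 := by
  cases ht : tdType β d <;> simp [reversalMask, ht]

theorem reversalMask_sub (hd : tdType β d = .IV → d = 3) {i : ℕ} (hi : i ≤ d) :
    reversalMask β d (d - i) i = 1 := by
  have hodd : tdType β d = .IIIminus ∨ tdType β d = .IV → ¬ Even d := by
    rintro (ht | ht)
    · exact Nat.not_even_iff_odd.2 (eq_neg_two_of_tdType_eq_IIIminus ht).2.2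
    · rw [hd ht]
      decide
  cases ht : tdType β d <;> simp only [reversalMask, ht, Nat.even_sub hi] <;> grind

end ReversalMask

namespace TridiagonalSystem

variable {F V : Type*} [Field F] [AddCommGroup V] [Module F V] {d : ℕ}
  {Φ : TridiagonalSystem F V d} {β : F} {e : TDScalars (AlgebraicClosure F)}

open TDScalars

section ClosedForms

namespace IsScalars

theorem q_ne_zero (h : Φ.IsScalars β e) (ht : tdType β d = .I) : e.q ≠ 0 := by
  simp only [IsScalars, ht] at h
  exact h.1

theorem theta_I (h : Φ.IsScalars β e) (ht : tdType β d = .I) {i : ℕ} (hi : i ≤ d) :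
    Φ.thetaBar i = e.a + e.b * ((e.q ^ i) ^ 2 / e.q ^ d) + e.c * (e.q ^ d / (e.q ^ i) ^ 2) ∧
    Φ.thetasBar i = e.as + e.bs * ((e.q ^ i) ^ 2 / e.q ^ d) +
      e.cs * (e.q ^ d / (e.q ^ i) ^ 2) := by
  rw [← zpow_two_mul_sub (h.q_ne_zero ht), ← zpow_sub_two_mul (h.q_ne_zero ht)]
  simp only [IsScalars, ht] at h
  exact h.2.2 i hi

theorem theta_II (h : Φ.IsScalars β e) (ht : tdType β d = .II) {i : ℕ} (hi : i ≤ d) :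
    Φ.thetaBar i = e.a + e.b * ((i : AlgebraicClosure F) - d / 2) + e.c * i * (d - i) ∧
    Φ.thetasBar i = e.as + e.bs * ((i : AlgebraicClosure F) - d / 2) + e.cs * i * (d - i) := by
  simp only [IsScalars, ht] at h
  exact h.2 i hi

theorem theta_III (h : Φ.IsScalars β e)
    (ht : tdType β d = .IIIplus ∨ tdType β d = .IIIminus) {i : ℕ} (hi : i ≤ d) :
    (Φ.thetaBar i = if Even i then e.a + e.b + e.c * ((i : AlgebraicClosure F) - d / 2)
      else e.a - e.b - e.c * ((i : AlgebraicClosure F) - d / 2)) ∧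
    (Φ.thetasBar i = if Even i then e.as + e.bs + e.cs * ((i : AlgebraicClosure F) - d / 2)
      else e.as - e.bs - e.cs * ((i : AlgebraicClosure F) - d / 2)) := by
  obtain ht | ht := ht <;>
  · simp only [IsScalars, ht] at h
    exact h.2 i hi

theorem theta_IV (h : Φ.IsScalars β e) (ht : tdType β d = .IV) :
    d = 3 ∧ (Φ.thetaBar 0 = e.a ∧ Φ.thetaBar 1 = e.b + e.c ∧
        Φ.thetaBar 2 = e.a + e.c ∧ Φ.thetaBar 3 = e.b) ∧
      (Φ.thetasBar 0 = e.as ∧ Φ.thetasBar 1 = e.bs + e.cs ∧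
        Φ.thetasBar 2 = e.as + e.cs ∧ Φ.thetasBar 3 = e.bs) := by
  simp only [IsScalars, ht] at h
  exact ⟨h.1, h.2.2⟩

end IsScalars

end ClosedForms

section Nonvanishing

theorem thetaBar_ne {i j : ℕ} (hi : i ≤ d) (hj : j ≤ d) (h : i ≠ j) :
    Φ.thetaBar i ≠ Φ.thetaBar j := fun he =>
  Φ.theta_ne hi hj h (FaithfulSMul.algebraMap_injective F (AlgebraicClosure F) he)

namespace IsScalars

variable {i : ℕ}

theorem pow_sub_inv_pow_ne_zero (h : Φ.IsScalars β e) (ht : tdType β d = .I) (hi : 1 ≤ i)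
    (hid : i ≤ d) : e.q ^ i - (e.q⁻¹) ^ i ≠ 0 := by
  intro h0
  rw [inv_pow, sub_eq_zero, ← mul_eq_one_iff_eq_inv₀ (pow_ne_zero i (h.q_ne_zero ht)), ← sq] at h0
  refine Φ.thetaBar_ne hid d.zero_le (by lia) ?_
  rw [(h.theta_I ht hid).1, (h.theta_I ht d.zero_le).1, h0, pow_zero, one_pow]

theorem natCast_ne_zero_of_II (h : Φ.IsScalars β e) (ht : tdType β d = .II) (hi : 1 ≤ i)
    (hid : i ≤ d) : (i : AlgebraicClosure F) ≠ 0 := by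
  intro h0
  refine Φ.thetaBar_ne hid d.zero_le (by lia) ?_
  rw [(h.theta_II ht hid).1, (h.theta_II ht d.zero_le).1, h0, Nat.cast_zero]

theorem natCast_ne_zero_of_III (h : Φ.IsScalars β e)
    (ht : tdType β d = .IIIplus ∨ tdType β d = .IIIminus) (hi : 1 ≤ i) (hid : i ≤ d)
    (heven : Even i) : (i : AlgebraicClosure F) ≠ 0 := by
  intro h0
  refine Φ.thetaBar_ne hid d.zero_le (by lia) ?_
  rw [(h.theta_III ht hid).1, (h.theta_III ht d.zero_le).1, h0, Nat.cast_zero, if_pos heven,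
    if_pos Even.zero]

theorem weight_ne_zero (h : Φ.IsScalars β e) (hi : 1 ≤ i) (hid : i ≤ d) :
    e.weight β d i ≠ 0 := by
  cases ht : tdType β d <;> simp only [weight, ht, ne_eq, one_ne_zero, not_false_eq_true]
  · exact pow_ne_zero 2 (h.pow_sub_inv_pow_ne_zero ht hi hid)
  · exact pow_ne_zero 2 (h.natCast_ne_zero_of_II ht hi hid)
  · split_ifs with heven
    · exact pow_ne_zero 2 (h.natCast_ne_zero_of_III (.inr ht) hi hid heven)
    · exact one_ne_zero

end IsScalars

end Nonvanishing

section NewtonReversal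

namespace IsScalars

theorem isNewtonReversal_I (h : Φ.IsScalars β e) (ht : tdType β d = .I) :
    IsNewtonReversal d (fun i => Φ.thetasBar 0 - Φ.thetasBar i) (weight β d e) Φ.thetaBar C
      (hatpFactor β d e) (hatpFactor β d (e.reversed β d)) (reversalMask β d) := by
  intro j i hji
  beta_reduce
  have hjd : j ≤ d := by lia
  have hq := h.q_ne_zero ht
  have hi := pow_ne_zero (i + 1) hq
  have hj := pow_ne_zero j hq
  have hd := pow_ne_zero d hq
  rw [(h.theta_I ht d.zero_le).2, (h.theta_I ht (by lia : i + 1 ≤ d)).2,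
    (h.theta_I ht hji).1, (h.theta_I ht hjd).1]
  simp only [reversalMask, weight, hatpFactor, reversed, ht, TDScalars.ddown,
    zpow_two_mul_sub_two_mul hq, inv_pow, map_one, one_mul]
  rw [sub_sub_sub_cancel_right, ← C_sub, ← C_mul, pow_sub₀ _ hq hjd, add_assoc j i 1,
    pow_add _ j (i + 1)]
  congr 1
  field_simp
  ring

theorem isNewtonReversal_II (h : Φ.IsScalars β e) (ht : tdType β d = .II) :
    IsNewtonReversal d (fun i => Φ.thetasBar 0 - Φ.thetasBar i) (weight β d e) Φ.thetaBar C
      (hatpFactor β d e) (hatpFactor β d (e.reversed β d)) (reversalMask β d) := by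
  intro j i hji
  beta_reduce
  have hjd : j ≤ d := by lia
  have htwo := algebraicClosure_two_ne_zero (eq_two_of_tdType_eq_II ht).2
  rw [(h.theta_II ht d.zero_le).2, (h.theta_II ht (by lia : i + 1 ≤ d)).2,
    (h.theta_II ht hji).1, (h.theta_II ht hjd).1]
  simp only [reversalMask, weight, hatpFactor, reversed, ht, map_one, one_mul]
  rw [sub_sub_sub_cancel_right, ← C_sub, ← C_mul, Nat.cast_sub hjd]
  congr 1
  push_cast
  field_simp
  ring

theorem isNewtonReversal_IIIminus (h : Φ.IsScalars β e) (ht : tdType β d = .IIIminus) :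
    IsNewtonReversal d (fun i => Φ.thetasBar 0 - Φ.thetasBar i) (weight β d e) Φ.thetaBar C
      (hatpFactor β d e) (hatpFactor β d (e.reversed β d)) (reversalMask β d) := by
  intro j i hji
  beta_reduce
  have hjd : j ≤ d := by lia
  obtain ⟨-, htwo, hd⟩ := eq_neg_two_of_tdType_eq_IIIminus ht
  replace htwo := algebraicClosure_two_ne_zero htwo
  rw [(h.theta_III (.inr ht) d.zero_le).2, (h.theta_III (.inr ht) (by lia : i + 1 ≤ d)).2,
    (h.theta_III (.inr ht) hji).1, (h.theta_III (.inr ht) hjd).1]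
  simp only [reversalMask, weight, hatpFactor, reversed, ht, Nat.even_sub hjd,
    Nat.not_even_iff_odd.2 hd, false_iff, Nat.even_add, Nat.not_even_one, iff_false]
  by_cases hi : Even i <;> by_cases hj : Even j <;>
    simp only [hi, hj, iff_true, iff_false, not_true_eq_false, not_false_eq_true, if_true,
      if_false, and_true, and_false, Even.zero, map_one, map_zero, one_mul, zero_mul, mul_zero,
      zero_sub, sub_zero, sub_self, sub_sub_sub_cancel_right, ← C_sub, ← C_mul, ← C_neg,
      Nat.cast_sub hjd, iff_self, and_self]
  all_goals
    congr 1
    push_cast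
    field_simp
    ring

theorem isNewtonReversal_IV (h : Φ.IsScalars β e) (ht : tdType β d = .IV) :
    IsNewtonReversal d (fun i => Φ.thetasBar 0 - Φ.thetasBar i) (weight β d e) Φ.thetaBar C
      (hatpFactor β d e) (hatpFactor β d (e.reversed β d)) (reversalMask β d) := by
  intro j i hji
  obtain ⟨rfl, ⟨h0, h1, h2, h3⟩, h0', h1', h2', h3'⟩ := h.theta_IV ht
  have htwo : (2 : (AlgebraicClosure F)[X]) = 0 := by
    rw [← C_ofNat, algebraicClosure_two_eq_zero (eq_zero_of_tdType_eq_IV ht).2, map_zero]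
  simp only [reversalMask, weight, hatpFactor, reversed, hatp, ht]
  have hj : j < 3 := by lia
  have hi : i < 3 := by lia
  interval_cases j <;> interval_cases i <;> first | lia | skip
  all_goals
    simp only [zero_add, Nat.reduceAdd, Nat.reduceSub, Nat.reduceEqDiff, if_true, if_false,
      Even.zero, Nat.not_even_one, not_true_eq_false, not_false_eq_true, and_true, and_false,
      even_two, show ¬ Even 3 by decide, h0, h1, h2, h3, h0', h1', h2', h3',
      map_one, map_zero, map_mul, map_sub, map_add, and_self]
    grind

theorem isNewtonReversal (h : Φ.IsScalars β e) (ht : tdType β d ≠ .IIIplus) :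
    IsNewtonReversal d (fun i => Φ.thetasBar 0 - Φ.thetasBar i) (weight β d e) Φ.thetaBar C
      (hatpFactor β d e) (hatpFactor β d (e.reversed β d)) (reversalMask β d) := by
  cases ht' : tdType β d with
  | I => exact h.isNewtonReversal_I ht'
  | II => exact h.isNewtonReversal_II ht'
  | IIIplus => exact absurd ht' ht
  | IIIminus => exact h.isNewtonReversal_IIIminus ht'
  | IV => exact h.isNewtonReversal_IV ht'

end IsScalars

end NewtonReversal

section Polynomials

theorem normalizedDrinfeld_eq (ht : tdType β d ≠ .IIIplus) :
    Φ.normalizedDrinfeld β e = ∑ i ∈ Finset.range (d + 1), C (Φ.zetaBar i) *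
      ∏ j ∈ Finset.Icc (i + 1) d, e.hatp β d j := by
  cases ht' : tdType β d <;> first | exact absurd ht' ht | simp only [normalizedDrinfeld, ht']

theorem normalizedDrinfeld_IIIplus (ht : tdType β d = .IIIplus) :
    Φ.normalizedDrinfeld β e = ∏ i ∈ Finset.Icc 1 d, Φ.p β e.q i := by
  simp only [normalizedDrinfeld, drinfeld, ht]

theorem drinfeld_eq (ht : tdType β d ≠ .IIIplus) (q : AlgebraicClosure F) :
    Φ.drinfeld β q = ∑ i ∈ Finset.range (d + 1), C (Φ.zetaBar i) *
      ∏ j ∈ Finset.Icc (i + 1) d, Φ.p β q j := by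
  cases ht' : tdType β d <;> first | exact absurd ht' ht | simp only [drinfeld, ht']

end Polynomials

section Relatives

theorem IsScalars.star (h : Φ.IsScalars β e) : Φ.star.IsScalars β e.star := by
  have hrat (he : e.IsRational) : e.star.IsRational := isRational_iff.2 (isRational_iff.1 he).symm
  cases ht : tdType β d <;> simp only [IsScalars, ht] at h ⊢
  · exact ⟨h.1, h.2.1, fun i hi => (h.2.2 i hi).symm⟩
  · exact ⟨hrat h.1, fun i hi => (h.2 i hi).symm⟩
  · exact ⟨hrat h.1, fun i hi => (h.2 i hi).symm⟩
  · exact ⟨hrat h.1, fun i hi => (h.2 i hi).symm⟩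
  · exact ⟨h.1, hrat h.2.1, h.2.2.symm⟩

theorem thetaBar_ddown {i : ℕ} (hi : i ≤ d) : Φ.ddown.thetaBar i = Φ.thetaBar (d - i) := by
  rw [thetaBar, theta_ddown _ hi, thetaBar]

theorem IsScalars.ddown_I (h : Φ.IsScalars β e) (ht : tdType β d = .I) :
    Φ.ddown.IsScalars β e.ddown := by
  simp only [IsScalars, ht] at h ⊢
  refine ⟨h.1, h.2.1, fun i hi => ⟨?_, (h.2.2 i hi).2⟩⟩
  rw [thetaBar_ddown hi, (h.2.2 _ (Nat.sub_le d i)).1, Nat.cast_sub hi]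
  simp only [TDScalars.ddown]
  rw [show 2 * ((d : ℤ) - i) - d = d - 2 * i by ring,
    show (d : ℤ) - 2 * (d - i) = 2 * i - d by ring]
  ring

theorem IsScalars.ddown_II (h : Φ.IsScalars β e) (ht : tdType β d = .II) :
    Φ.ddown.IsScalars β (e.reversed β d) := by
  have htwo := algebraicClosure_two_ne_zero (eq_two_of_tdType_eq_II ht).2
  simp only [IsScalars, ht, reversed] at h ⊢
  refine ⟨isRational_iff.2 (by simpa only [neg_mem_iff] using isRational_iff.1 h.1),
    fun i hi => ⟨?_, (h.2 i hi).2⟩⟩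
  rw [thetaBar_ddown hi, (h.2 _ (Nat.sub_le d i)).1, Nat.cast_sub hi]
  field_simp
  ring

theorem IsScalars.ddown_IIIplus (h : Φ.IsScalars β e) (ht : tdType β d = .IIIplus) :
    Φ.ddown.IsScalars β (e.reversed β d) := by
  obtain ⟨-, htwo, hd⟩ := eq_neg_two_of_tdType_eq_IIIplus ht
  replace htwo := algebraicClosure_two_ne_zero htwo
  simp only [IsScalars, ht, reversed] at h ⊢
  refine ⟨isRational_iff.2 (by simpa only [neg_mem_iff] using isRational_iff.1 h.1),
    fun i hi => ⟨?_, (h.2 i hi).2⟩⟩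
  rw [thetaBar_ddown hi, (h.2 _ (Nat.sub_le d i)).1, Nat.cast_sub hi]
  simp only [Nat.even_sub hi, hd, true_iff]
  split_ifs <;>
  · field_simp
    ring

theorem IsScalars.ddown_IIIminus (h : Φ.IsScalars β e) (ht : tdType β d = .IIIminus) :
    Φ.ddown.IsScalars β (e.reversed β d) := by
  obtain ⟨-, htwo, hd⟩ := eq_neg_two_of_tdType_eq_IIIminus ht
  replace htwo := algebraicClosure_two_ne_zero htwo
  simp only [IsScalars, ht, reversed] at h ⊢
  refine ⟨isRational_iff.2 (by simpa only [neg_mem_iff] using isRational_iff.1 h.1),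
    fun i hi => ⟨?_, (h.2 i hi).2⟩⟩
  rw [thetaBar_ddown hi, (h.2 _ (Nat.sub_le d i)).1, Nat.cast_sub hi]
  simp only [Nat.even_sub hi, Nat.not_even_iff_odd.2 hd, false_iff]
  by_cases hi : Even i <;>
  · simp only [hi, not_true_eq_false, not_false_eq_true, if_true, if_false]
    field_simp
    ring

theorem IsScalars.ddown_IV (h : Φ.IsScalars β e) (ht : tdType β d = .IV) :
    Φ.ddown.IsScalars β (e.reversed β d) := by
  simp only [IsScalars, ht, reversed] at h ⊢
  obtain ⟨rfl, hrat, ⟨h0, h1, h2, h3⟩, hs⟩ := h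
  rw [isRational_iff] at hrat
  refine ⟨rfl, isRational_iff.2 (by tauto), ?_, hs⟩
  rw [thetaBar_ddown (by lia), thetaBar_ddown (by lia), thetaBar_ddown (by lia),
    thetaBar_ddown le_rfl]
  exact ⟨h3, h2, h1, h0⟩

theorem IsScalars.ddown (h : Φ.IsScalars β e) : Φ.ddown.IsScalars β (e.reversed β d) := by
  cases ht : tdType β d with
  | I => simpa only [reversed, ht] using h.ddown_I ht
  | II => exact h.ddown_II ht
  | IIIplus => exact h.ddown_IIIplus ht
  | IIIminus => exact h.ddown_IIIminus ht
  | IV => exact h.ddown_IV ht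

end Relatives

section Invariance

theorem p_star (ht : tdType β d = .IIIplus) (q : AlgebraicClosure F) (i : ℕ) :
    Φ.star.p β q i = Φ.p β q i := by
  have hθ : Φ.star.thetaBar = Φ.thetasBar := rfl
  have hθs : Φ.star.thetasBar = Φ.thetaBar := rfl
  simp only [p, ht, alpha, hθ, hθs]
  rw [mul_comm (Φ.thetasBar 0), mul_comm (Φ.thetasBar d), mul_comm (Φ.thetasBar 0 - _),
    add_comm (Φ.thetaBar d * _)]

theorem hatp_star (β : F) (d : ℕ) (e : TDScalars (AlgebraicClosure F)) (i : ℕ) :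
    e.star.hatp β d i = e.hatp β d i := by
  cases ht : tdType β d <;> simp only [hatp, ht, TDScalars.star] <;> ring_nf

theorem IsSharp.normalizedDrinfeld_star (h : Φ.IsSharp) (e : TDScalars (AlgebraicClosure F)) :
    Φ.star.normalizedDrinfeld β e.star = Φ.normalizedDrinfeld β e := by
  by_cases ht : tdType β d = .IIIplus
  · rw [normalizedDrinfeld_IIIplus ht, normalizedDrinfeld_IIIplus ht]
    exact Finset.prod_congr rfl fun i _ => p_star ht _ i
  · rw [normalizedDrinfeld_eq ht, normalizedDrinfeld_eq ht]
    simp only [zetaBar, h.zeta_star, hatp_star]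

theorem IsScalars.p_IIIplus_of_even (h : Φ.IsScalars β e) (ht : tdType β d = .IIIplus)
    (q : AlgebraicClosure F) {i : ℕ} (hi : 1 ≤ i) (hid : i ≤ d) (heven : Even i) :
    Φ.p β q i = (C (Φ.thetaBar 0 * Φ.thetasBar 0 + Φ.thetaBar d * Φ.thetasBar d) - X) *
      C ((i : AlgebraicClosure F) ^ 2 / (d : AlgebraicClosure F) ^ 2) := by
  obtain ⟨-, htwo, hd_even⟩ := eq_neg_two_of_tdType_eq_IIIplus ht
  replace htwo := algebraicClosure_two_ne_zero htwo
  have hd := h.natCast_ne_zero_of_III (.inl ht) (hi.trans hid) le_rfl hd_even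
  have hθ0 := h.theta_III (.inl ht) d.zero_le
  have hθi := h.theta_III (.inl ht) hid
  have hθd := h.theta_III (.inl ht) le_rfl
  simp only [Even.zero, heven, hd_even, if_true] at hθ0 hθi hθd
  simp only [p, ht, alpha, if_pos heven, hθ0, hθi, hθd, sub_mul, ← C_mul]
  rw [sub_add_eq_add_sub, ← C_add]
  congr 2
  push_cast
  field_simp
  ring

theorem p_IIIplus_of_not_even (ht : tdType β d = .IIIplus) (q : AlgebraicClosure F) {i : ℕ}
    (hodd : ¬ Even i) :
    Φ.p β q i = C (Φ.thetaBar 0 * Φ.thetasBar d + Φ.thetaBar d * Φ.thetasBar 0) - X := by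
  simp only [p, ht, alpha, if_neg hodd, map_one, mul_one]

theorem IsScalars.prod_p_IIIplus (h : Φ.IsScalars β e) (ht : tdType β d = .IIIplus)
    (q : AlgebraicClosure F) :
    ∏ i ∈ Finset.Icc 1 d, Φ.p β q i =
      (∏ i ∈ Finset.Icc 1 d,
        if Even i then C (Φ.thetaBar 0 * Φ.thetasBar 0 + Φ.thetaBar d * Φ.thetasBar d) - X
        else C (Φ.thetaBar 0 * Φ.thetasBar d + Φ.thetaBar d * Φ.thetasBar 0) - X) *
      ∏ i ∈ Finset.Icc 1 d, if Even i then
        C ((i : AlgebraicClosure F) ^ 2 / (d : AlgebraicClosure F) ^ 2) else 1 := by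
  rw [← Finset.prod_mul_distrib]
  refine Finset.prod_congr rfl fun i hi => ?_
  obtain ⟨hi, hid⟩ := Finset.mem_Icc.1 hi
  split_ifs with heven
  · exact h.p_IIIplus_of_even ht q hi hid heven
  · rw [p_IIIplus_of_not_even ht q heven, mul_one]

theorem prod_Icc_ite_even_comm {M : Type*} [CommMonoid M] (x y : M) {d : ℕ} (hd : Even d) :
    ∏ i ∈ Finset.Icc 1 d, (if Even i then x else y) =
      ∏ i ∈ Finset.Icc 1 d, (if Even i then y else x) := by
  obtain ⟨n, rfl⟩ := hd
  induction n with
  | zero => rfl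
  | succ n ih =>
    rw [show n + 1 + (n + 1) = n + n + 1 + 1 by ring]
    simp only [Finset.prod_Icc_succ_top (Nat.le_add_left 1 _), ih]
    simp [Nat.even_add_one, mul_assoc, mul_comm x y]

theorem IsScalars.normalizedDrinfeld_ddown_of_IIIplus (h : Φ.IsScalars β e)
    (ht : tdType β d = .IIIplus) :
    Φ.ddown.normalizedDrinfeld β (e.reversed β d) = Φ.normalizedDrinfeld β e := by
  have hθs : Φ.ddown.thetasBar = Φ.thetasBar := rfl
  rw [normalizedDrinfeld_IIIplus ht, normalizedDrinfeld_IIIplus ht, h.prod_p_IIIplus ht,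
    h.ddown.prod_p_IIIplus ht, hθs, thetaBar_ddown d.zero_le, thetaBar_ddown le_rfl, Nat.sub_self,
    Nat.sub_zero, add_comm (Φ.thetaBar d * Φ.thetasBar 0), add_comm (Φ.thetaBar d * Φ.thetasBar d),
    prod_Icc_ite_even_comm _ _ (eq_neg_two_of_tdType_eq_IIIplus ht).2.2]

theorem sum_C_mul_eq_sum_C_mul_sum {R σ τ : Type*} [CommSemiring R] [Fintype σ] {s : Finset τ}
    {z : τ → R} {μ : σ → R} {g : σ → τ → R} (hz : ∀ i ∈ s, z i = ∑ m, μ m * g m i)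
    (Q : τ → R[X]) :
    ∑ i ∈ s, C (z i) * Q i = ∑ m, C (μ m) * ∑ i ∈ s, C (g m i) * Q i := by
  simp only [Finset.mul_sum]
  rw [Finset.sum_comm]
  refine Finset.sum_congr rfl fun i hi => ?_
  rw [hz i hi, map_sum, Finset.sum_mul]
  simp only [map_mul, mul_assoc]

theorem IsSharp.exists_common_moments_bar (h : Φ.IsSharp) :
    ∃ μ : Fin (d + 1) → AlgebraicClosure F, ∀ i ∈ Finset.range (d + 1),
      Φ.zetaBar i = ∑ m, μ m * ((∏ k ∈ Finset.range i, (Φ.thetasBar 0 - Φ.thetasBar (k + 1))) *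
        ∏ k ∈ Finset.range i, (Φ.thetaBar m - Φ.thetaBar k)) ∧
      Φ.ddown.zetaBar i = ∑ m, μ m *
        ((∏ k ∈ Finset.range i, (Φ.thetasBar 0 - Φ.thetasBar (k + 1))) *
          ∏ k ∈ Finset.range i, (Φ.thetaBar m - Φ.thetaBar (d - k))) := by
  obtain ⟨μ, hμ⟩ := h.exists_common_moments
  refine ⟨fun m => algebraMap F _ (μ m), fun i hi => ?_⟩
  obtain ⟨hzeta, hzeta'⟩ := hμ i (Nat.lt_succ_iff.1 (Finset.mem_range.1 hi))
  simp only [zetaBar, hzeta, hzeta', thetaBar, thetasBar, Finset.mul_sum, map_sum, map_mul,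
    map_prod, map_sub]
  exact ⟨Finset.sum_congr rfl fun m _ => mul_left_comm _ _ _,
    Finset.sum_congr rfl fun m _ => mul_left_comm _ _ _⟩

theorem IsScalars.normalizedDrinfeld_ddown_of_ne_IIIplus (h : Φ.IsScalars β e) (hΦ : Φ.IsSharp)
    (ht : tdType β d ≠ .IIIplus) :
    Φ.ddown.normalizedDrinfeld β (e.reversed β d) = Φ.normalizedDrinfeld β e := by
  obtain ⟨μ, hμ⟩ := hΦ.exists_common_moments_bar
  rw [normalizedDrinfeld_eq ht, normalizedDrinfeld_eq ht,
    sum_C_mul_eq_sum_C_mul_sum fun i hi => (hμ i hi).1,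
    sum_C_mul_eq_sum_C_mul_sum fun i hi => (hμ i hi).2]
  simp only [hatp_eq, weight_reversed]
  refine Finset.sum_congr rfl fun m _ => congrArg _ (Eq.symm ?_)
  exact newton_sum_eq_newton_sum_reversed (f := fun i => Φ.thetasBar 0 - Φ.thetasBar i)
    (fun i => h.weight_ne_zero) reversalMask_zero_left
    (fun i => reversalMask_sub fun ht => (h.theta_IV ht).1) (h.isNewtonReversal ht)
    (Nat.lt_succ_iff.1 m.2)

theorem IsScalars.normalizedDrinfeld_ddown (h : Φ.IsScalars β e) (hΦ : Φ.IsSharp) :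
    Φ.ddown.normalizedDrinfeld β (e.reversed β d) = Φ.normalizedDrinfeld β e := by
  by_cases ht : tdType β d = .IIIplus
  · exact h.normalizedDrinfeld_ddown_of_IIIplus ht
  · exact h.normalizedDrinfeld_ddown_of_ne_IIIplus hΦ ht

end Invariance

end TridiagonalSystem

section Composition

theorem C_sub_X_mul_C_add_C_comp_linear {R : Type*} [CommRing R] (L α k u v : R) :
    ((C L - X) * C α + C k).comp (C u * X + C v) = C ((L - v) * α + k) - C (u * α) * X := by
  simp only [add_comp, mul_comp, sub_comp, C_comp, X_comp, C_add, C_mul, C_sub]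
  ring

namespace TridiagonalSystem

open TDScalars

variable {F V : Type*} [Field F] [AddCommGroup V] [Module F V] {d i : ℕ}
  {Φ : TridiagonalSystem F V d} {β : F} {e : TDScalars (AlgebraicClosure F)}

namespace IsScalars

theorem p_comp_I (h : Φ.IsScalars β e) (ht : tdType β d = .I) (hi : 1 ≤ i) (hid : i ≤ d) :
    (Φ.p β e.q i).comp (C (e.u β d) * X + C (e.v β d)) = e.hatp β d i := by
  have hq := h.q_ne_zero ht
  have hu := pow_ne_zero 2 (h.pow_sub_inv_pow_ne_zero ht (hi.trans hid) le_rfl)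
  simp only [p, ht, alpha, hatp, TDScalars.u, TDScalars.v, C_sub_X_mul_C_add_C_comp_linear]
  rw [mul_div_cancel₀ _ hu, mul_sub (C _) (C _), ← C_mul]
  congr 2
  rw [(h.theta_I ht hid).1, (h.theta_I ht hid).2, (h.theta_I ht d.zero_le).1,
    (h.theta_I ht d.zero_le).2, (h.theta_I ht le_rfl).1, (h.theta_I ht le_rfl).2,
    zpow_two_mul_sub_two_mul hq, zpow_two_mul_sub_two_mul hq, pow_zero]
  have hx := pow_ne_zero i hq
  have hy := pow_ne_zero d hq
  simp only [inv_pow] at hu ⊢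
  set x := e.q ^ i
  set y := e.q ^ d
  -- `θ₀ θ*_d + θ_d θ*₀ - v = (b c* + c b*) u`, so the division by `u` in `αᵢ` cancels.
  have hcancel : ∀ L M N : AlgebraicClosure F, L = M * (y - y⁻¹) ^ 2 →
      L * ((x - x⁻¹) ^ 2 / (y - y⁻¹) ^ 2) + N = M * (x - x⁻¹) ^ 2 + N := by
    rintro L M N rfl
    rw [mul_assoc, mul_div_cancel₀ _ hu]
  rw [hcancel _ (e.b * e.cs + e.c * e.bs)] <;>
  · field_simp
    ring

theorem p_comp_II (h : Φ.IsScalars β e) (ht : tdType β d = .II) (hi : 1 ≤ i) (hid : i ≤ d) :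
    (Φ.p β e.q i).comp (C (e.u β d) * X + C (e.v β d)) = e.hatp β d i := by
  have htwo := algebraicClosure_two_ne_zero (eq_two_of_tdType_eq_II ht).2
  have hd := h.natCast_ne_zero_of_II ht (hi.trans hid) le_rfl
  simp only [p, ht, alpha, hatp, TDScalars.u, TDScalars.v, C_sub_X_mul_C_add_C_comp_linear]
  rw [mul_div_cancel₀ _ (pow_ne_zero 2 hd), mul_sub (C _) (C _), ← C_mul]
  congr 2
  rw [(h.theta_II ht hid).1, (h.theta_II ht hid).2, (h.theta_II ht d.zero_le).1,
    (h.theta_II ht d.zero_le).2, (h.theta_II ht le_rfl).1, (h.theta_II ht le_rfl).2]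
  push_cast
  field_simp
  ring

theorem p_comp_IIIminus (h : Φ.IsScalars β e) (ht : tdType β d = .IIIminus) (hid : i ≤ d) :
    (Φ.p β e.q i).comp (C (e.u β d) * X + C (e.v β d)) = e.hatp β d i := by
  obtain ⟨-, htwo, hd⟩ := eq_neg_two_of_tdType_eq_IIIminus ht
  replace htwo := algebraicClosure_two_ne_zero htwo
  replace hd := Nat.not_even_iff_odd.2 hd
  simp only [p, ht, alpha, hatp, TDScalars.u, TDScalars.v, C_sub_X_mul_C_add_C_comp_linear]
  rw [(h.theta_III (.inr ht) hid).1, (h.theta_III (.inr ht) hid).2,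
    (h.theta_III (.inr ht) d.zero_le).1, (h.theta_III (.inr ht) d.zero_le).2,
    (h.theta_III (.inr ht) le_rfl).1, (h.theta_III (.inr ht) le_rfl).2]
  by_cases heven : Even i
  · simp only [heven, hd, Even.zero, if_true, if_false, mul_zero, C_0, zero_mul, sub_zero]
    congr 1
    push_cast
    ring
  · simp only [heven, hd, Even.zero, if_true, if_false, mul_one, C_1, one_mul]
    congr 2
    push_cast
    field_simp
    ring

theorem p_comp_IV (h : Φ.IsScalars β e) (ht : tdType β d = .IV) (hi : 1 ≤ i) (hid : i ≤ d) :
    (Φ.p β e.q i).comp (C (e.u β d) * X + C (e.v β d)) = e.hatp β d i := by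
  obtain ⟨rfl, ⟨h0, h1, h2, h3⟩, h0', h1', h2', h3'⟩ := h.theta_IV ht
  have htwo : (2 : (AlgebraicClosure F)[X]) = 0 := by
    rw [← C_ofNat, algebraicClosure_two_eq_zero (eq_zero_of_tdType_eq_IV ht).2, map_zero]
  simp only [p, ht, alpha, hatp, TDScalars.u, TDScalars.v, C_sub_X_mul_C_add_C_comp_linear]
  interval_cases i
  all_goals
    simp only [Nat.reduceEqDiff, if_true, if_false, Nat.not_even_one, even_two,
      show ¬ Even 3 by decide, h0, h1, h2, h3, h0', h1', h2', h3', C_0, C_1, C_add, C_mul, C_sub]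
    grind

theorem p_comp (h : Φ.IsScalars β e) (ht : tdType β d ≠ .IIIplus) (hi : 1 ≤ i) (hid : i ≤ d) :
    (Φ.p β e.q i).comp (C (e.u β d) * X + C (e.v β d)) = e.hatp β d i := by
  cases ht' : tdType β d with
  | I => exact h.p_comp_I ht' hi hid
  | II => exact h.p_comp_II ht' hi hid
  | IIIplus => exact absurd ht' ht
  | IIIminus => exact h.p_comp_IIIminus ht' hid
  | IV => exact h.p_comp_IV ht' hi hid

theorem normalizedDrinfeld_eq_comp (h : Φ.IsScalars β e) :
    Φ.normalizedDrinfeld β e = (Φ.drinfeld β e.q).comp (C (e.u β d) * X + C (e.v β d)) := by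
  by_cases ht : tdType β d = .IIIplus
  · simp only [normalizedDrinfeld, TDScalars.u, TDScalars.v, ht, map_one, one_mul, map_zero,
      add_zero, comp_X]
  · rw [normalizedDrinfeld_eq ht, drinfeld_eq ht, ← coe_compRingHom_apply, map_sum]
    refine Finset.sum_congr rfl fun i _ => ?_
    rw [coe_compRingHom_apply, mul_comp, C_comp, prod_comp]
    refine congrArg _ (Finset.prod_congr rfl fun j hj => ?_)
    obtain ⟨hij, hjd⟩ := Finset.mem_Icc.1 hj
    exact (h.p_comp ht (Nat.le_of_add_left_le hij) hjd).symm

end IsScalars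

end TridiagonalSystem

end Composition

section Coefficients

variable {K : Type*} [Field K] {a b c a' b' c' : K} {d : ℕ}

theorem eq_or_eq_inv_of_add_inv_eq_add_inv {x y : K} (hx : x ≠ 0) (hy : y ≠ 0)
    (h : x + x⁻¹ = y + y⁻¹) : x = y ∨ x = y⁻¹ := by
  have hprod : (x - y) * (x - y⁻¹) = 0 := by
    linear_combination mul_inv_cancel₀ hy - mul_inv_cancel₀ hx + x * h
  exact (mul_eq_zero.1 hprod).imp sub_eq_zero.1 sub_eq_zero.1

theorem coeff_eq_of_geometric_eq {Q : K} (hQ : Q ≠ 0) (hQ2 : Q ^ 2 ≠ 1)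
    (h : ∀ i ≤ 2, a + b * Q ^ i + c * Q⁻¹ ^ i = a' + b' * Q ^ i + c' * Q⁻¹ ^ i) :
    b = b' ∧ c = c' := by
  have hsub2 : Q ^ 2 - 1 ≠ 0 := sub_ne_zero.2 hQ2
  have hsub : Q - 1 ≠ 0 := fun h0 => hsub2 (by linear_combination (Q + 1) * h0)
  have h0 := h 0 (by lia)
  have h1 := h 1 (by lia)
  have h2 := h 2 le_rfl
  have hinv : Q * Q⁻¹ = 1 := mul_inv_cancel₀ hQ
  have hfst : (b - b') * Q = c - c' := by
    apply mul_left_cancel₀ hsub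
    linear_combination Q * (h1 - h0) - (c - c') * hinv
  have hsnd : (b - b') * Q ^ 2 = c - c' := by
    apply mul_left_cancel₀ hsub2
    linear_combination Q ^ 2 * (h2 - h0) - (c - c') * (Q * Q⁻¹ + 1) * hinv
  have hb : b - b' = 0 := by
    have hprod : (b - b') * (Q * (Q - 1)) = 0 := by linear_combination hsnd - hfst
    exact (mul_eq_zero.1 hprod).resolve_right (mul_ne_zero hQ hsub)
  refine ⟨sub_eq_zero.1 hb, sub_eq_zero.1 ?_⟩
  rw [← hfst, hb, zero_mul]

theorem coeff_eq_of_quadratic_eq {i : ℕ} (hd : (d : K) ≠ 0) (hi : (i : K) ≠ 0) (hid : i ≤ d)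
    (h : ∀ n ≤ d, a + b * ((n : K) - d / 2) + c * n * (d - n) =
      a' + b' * ((n : K) - d / 2) + c' * n * (d - n)) :
    b = b' ∧ c * (d - i) = c' * (d - i) := by
  have h0 := h 0 d.zero_le
  push_cast at h0
  have hb : b = b' := mul_right_cancel₀ hd (by linear_combination h d le_rfl - h0)
  subst hb
  have ha : a = a' := by linear_combination h0
  subst ha
  exact ⟨rfl, mul_left_cancel₀ hi (by linear_combination h i hid)⟩

theorem coeff_eq_of_alternating_eq (htwo : (2 : K) ≠ 0) (hd : ¬ Even d)
    (h : ∀ n ≤ d, (if Even n then a + b + c * ((n : K) - d / 2) else a - b - c * (n - d / 2)) =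
      if Even n then a' + b' + c' * ((n : K) - d / 2) else a' - b' - c' * (n - d / 2)) :
    b = b' ∧ (2 ≤ d → c = c') := by
  have h0 := h 0 d.zero_le
  have hend := h d le_rfl
  simp only [Even.zero, if_true, hd, if_false, Nat.cast_zero] at h0 hend
  refine ⟨mul_left_cancel₀ htwo ?_, fun hd2 => mul_left_cancel₀ htwo ?_⟩
  · have hhalf : (d : K) * 2⁻¹ * 2 = d := inv_mul_cancel_right₀ htwo _
    linear_combination h0 - hend + (c - c') * hhalf
  · have h2 := h 2 hd2
    simp only [even_two, if_true, Nat.cast_ofNat] at h2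
    linear_combination h2 - h0

end Coefficients

namespace TridiagonalSystem

open TDScalars

variable {F V : Type*} [Field F] [AddCommGroup V] [Module F V] {d i : ℕ}
  {Φ : TridiagonalSystem F V d} {β : F} {e e' : TDScalars (AlgebraicClosure F)}

section Uniqueness

theorem hatp_I (ht : tdType β d = .I) (hq : e.q ≠ 0) (i : ℕ) :
    e.hatp β d i = C ((e.q ^ 2) ^ i - 2 + (e.q ^ 2)⁻¹ ^ i) *
      (C (e.b / e.q ^ d * (e.bs / e.q ^ d) * (e.q ^ 2) ^ i +
        e.c * e.q ^ d * (e.cs * e.q ^ d) * (e.q ^ 2)⁻¹ ^ i) - X) := by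
  have hi := pow_ne_zero i hq
  have hd := pow_ne_zero d hq
  simp only [hatp, ht]
  rw [zpow_two_mul_sub_two_mul hq, zpow_two_mul_sub_two_mul hq, inv_pow, inv_pow,
    pow_right_comm e.q 2 i]
  congr 2
  · field_simp
    ring
  · congr 1
    field_simp

namespace IsScalars

theorem sq_add_inv_sq_eq (h : Φ.IsScalars β e) (ht : tdType β d = .I) :
    e.q ^ 2 + (e.q⁻¹) ^ 2 = algebraMap F (AlgebraicClosure F) β := by
  simp only [IsScalars, ht] at h
  exact h.2.1

theorem sq_sq_ne_one (h : Φ.IsScalars β e) (ht : tdType β d = .I) : (e.q ^ 2) ^ 2 ≠ 1 := by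
  obtain ⟨hne, hne'⟩ := tdType_eq_I_iff.1 ht
  have hinj := FaithfulSMul.algebraMap_injective F (AlgebraicClosure F)
  refine sq_sq_ne_one_of_sq_add_inv_sq_eq (h.sq_add_inv_sq_eq ht) (fun hβ => hne (hinj ?_))
    fun hβ => hne' (hinj ?_)
  · rw [hβ, algebraMap_algebraicClosure_two]
  · rw [hβ, map_neg, algebraMap_algebraicClosure_two]

theorem theta_I_eq_geometric (h : Φ.IsScalars β e) (ht : tdType β d = .I) (hi : i ≤ d) :
    Φ.thetaBar i = e.a + e.b / e.q ^ d * (e.q ^ 2) ^ i + e.c * e.q ^ d * (e.q ^ 2)⁻¹ ^ i ∧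
    Φ.thetasBar i = e.as + e.bs / e.q ^ d * (e.q ^ 2) ^ i +
      e.cs * e.q ^ d * (e.q ^ 2)⁻¹ ^ i := by
  rw [(h.theta_I ht hi).1, (h.theta_I ht hi).2, inv_pow, pow_right_comm]
  constructor <;> ring

theorem hatp_unique_I (h : Φ.IsScalars β e) (h' : Φ.IsScalars β e') (ht : tdType β d = .I)
    (hd : 2 ≤ d) (i : ℕ) : e.hatp β d i = e'.hatp β d i := by
  have hq := h.q_ne_zero ht
  have hq' := h'.q_ne_zero ht
  have hQ := pow_ne_zero 2 hq
  have hQ2 := h.sq_sq_ne_one ht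
  have hbase : e'.q ^ 2 + (e'.q ^ 2)⁻¹ = e.q ^ 2 + (e.q ^ 2)⁻¹ := by
    rw [← inv_pow, ← inv_pow, h.sq_add_inv_sq_eq ht, h'.sq_add_inv_sq_eq ht]
  have hθ := fun i (hi : i ≤ 2) => (h.theta_I_eq_geometric ht (hi.trans hd)).1.symm.trans
    (h'.theta_I_eq_geometric ht (hi.trans hd)).1
  have hθs := fun i (hi : i ≤ 2) => (h.theta_I_eq_geometric ht (hi.trans hd)).2.symm.trans
    (h'.theta_I_eq_geometric ht (hi.trans hd)).2
  rw [hatp_I ht hq, hatp_I ht hq']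
  obtain hsq | hsq := eq_or_eq_inv_of_add_inv_eq_add_inv (pow_ne_zero 2 hq') hQ hbase
  · rw [hsq] at hθ hθs ⊢
    obtain ⟨hb, hc⟩ := coeff_eq_of_geometric_eq hQ hQ2 hθ
    obtain ⟨hbs, hcs⟩ := coeff_eq_of_geometric_eq hQ hQ2 hθs
    rw [hb, hc, hbs, hcs]
  · rw [hsq, inv_inv] at hθ hθs ⊢
    obtain ⟨hb, hc⟩ :=
      coeff_eq_of_geometric_eq hQ hQ2 fun i hi => (hθ i hi).trans (add_right_comm _ _ _)
    obtain ⟨hbs, hcs⟩ :=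
      coeff_eq_of_geometric_eq hQ hQ2 fun i hi => (hθs i hi).trans (add_right_comm _ _ _)
    rw [hb, hc, hbs, hcs, add_comm (_ * (e.q ^ 2) ^ i), sub_add_eq_add_sub, sub_add_eq_add_sub,
      add_comm ((e.q ^ 2) ^ i)]

theorem hatp_unique_II (h : Φ.IsScalars β e) (h' : Φ.IsScalars β e') (ht : tdType β d = .II)
    (hi : 1 ≤ i) (hid : i ≤ d) : e.hatp β d i = e'.hatp β d i := by
  have hi0 := h.natCast_ne_zero_of_II ht hi hid
  have hd0 := h.natCast_ne_zero_of_II ht (hi.trans hid) le_rfl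
  obtain ⟨hb, hc⟩ := coeff_eq_of_quadratic_eq hd0 hi0 hid fun n hn =>
    (h.theta_II ht hn).1.symm.trans (h'.theta_II ht hn).1
  obtain ⟨hbs, hcs⟩ := coeff_eq_of_quadratic_eq hd0 hi0 hid fun n hn =>
    (h.theta_II ht hn).2.symm.trans (h'.theta_II ht hn).2
  simp only [hatp, ht]
  congr 3
  rw [hb, hbs]
  linear_combination e'.b * hcs + e'.bs * hc + e.cs * (d - i) * hc + e'.c * (d - i) * hcs

theorem hatp_unique_IIIminus (h : Φ.IsScalars β e) (h' : Φ.IsScalars β e')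
    (ht : tdType β d = .IIIminus) (hi : 1 ≤ i) (hid : i ≤ d) :
    e.hatp β d i = e'.hatp β d i := by
  obtain ⟨-, htwo, hd⟩ := eq_neg_two_of_tdType_eq_IIIminus ht
  replace htwo := algebraicClosure_two_ne_zero htwo
  replace hd := Nat.not_even_iff_odd.2 hd
  obtain ⟨hb, hc⟩ := coeff_eq_of_alternating_eq htwo hd fun n hn =>
    (h.theta_III (.inr ht) hn).1.symm.trans (h'.theta_III (.inr ht) hn).1
  obtain ⟨hbs, hcs⟩ := coeff_eq_of_alternating_eq htwo hd fun n hn =>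
    (h.theta_III (.inr ht) hn).2.symm.trans (h'.theta_III (.inr ht) hn).2
  simp only [hatp, ht]
  by_cases hd2 : 2 ≤ d
  · rw [hb, hc hd2, hbs, hcs hd2]
  · obtain rfl : i = 1 := by lia
    obtain rfl : d = 1 := by lia
    simp [hb, hbs]

theorem hatp_unique_IV (h : Φ.IsScalars β e) (h' : Φ.IsScalars β e') (ht : tdType β d = .IV)
    (i : ℕ) : e.hatp β d i = e'.hatp β d i := by
  obtain ⟨-, ⟨h0, -, h2, h3⟩, h0', -, h2', h3'⟩ := h.theta_IV ht
  obtain ⟨-, ⟨g0, -, g2, g3⟩, g0', -, g2', g3'⟩ := h'.theta_IV ht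
  have ha : e.a = e'.a := h0.symm.trans g0
  have hb : e.b = e'.b := h3.symm.trans g3
  have hc : e.c = e'.c := by linear_combination g2 - h2 - ha
  have has : e.as = e'.as := h0'.symm.trans g0'
  have hbs : e.bs = e'.bs := h3'.symm.trans g3'
  have hcs : e.cs = e'.cs := by linear_combination g2' - h2' - has
  simp only [hatp, ht, ha, hb, hc, has, hbs, hcs]

theorem hatp_unique (h : Φ.IsScalars β e) (h' : Φ.IsScalars β e')
    (hI : tdType β d = .I → d ≠ 1) (hi : 1 ≤ i) (hid : i ≤ d) :
    e.hatp β d i = e'.hatp β d i := by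
  cases ht : tdType β d with
  | I =>
    have := hI ht
    exact h.hatp_unique_I h' ht (by lia) i
  | II => exact h.hatp_unique_II h' ht hi hid
  | IIIplus => simp only [hatp, ht]
  | IIIminus => exact h.hatp_unique_IIIminus h' ht hi hid
  | IV => exact h.hatp_unique_IV h' ht i

theorem normalizedDrinfeld_unique (h : Φ.IsScalars β e) (h' : Φ.IsScalars β e')
    (hI : tdType β d = .I → d ≠ 1) : Φ.normalizedDrinfeld β e = Φ.normalizedDrinfeld β e' := by
  by_cases ht : tdType β d = .IIIplus
  · simp only [normalizedDrinfeld, drinfeld, p, alpha, ht]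
  · rw [normalizedDrinfeld_eq ht, normalizedDrinfeld_eq ht]
    refine Finset.sum_congr rfl fun i _ => congrArg _ (Finset.prod_congr rfl fun j hj => ?_)
    obtain ⟨hij, hjd⟩ := Finset.mem_Icc.1 hj
    exact h.hatp_unique h' hI (Nat.le_of_add_left_le hij) hjd

end IsScalars

end Uniqueness

section Dihedral

/-- The relative of `Φ` under `g` is sharp and has scalars that give it the same normalized
Drinfel'd polynomial as the scalars `e` give to `Φ`; for type I these are the transported scalars.
This is the invariance property that passes from the generators to all of `D₄`. -/
def HasTransportedScalars (Φ : TridiagonalSystem F V d) (β : F)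
    (e : TDScalars (AlgebraicClosure F)) (g : D4) : Prop :=
  (d4 g Φ).IsSharp ∧ ∃ e₀, (d4 g Φ).IsScalars β e₀ ∧
    (d4 g Φ).normalizedDrinfeld β e₀ = Φ.normalizedDrinfeld β e ∧
    (tdType β d = .I → e₀ = TDScalars.d4 g e)

theorem d4_of (x : D4Gen) : d4 (PresentedGroup.of x) =
    (genPerm x : Equiv.Perm (TridiagonalSystem F V d)) :=
  PresentedGroup.toGroup.of _

theorem _root_.TDScalars.d4_of {K : Type*} (x : D4Gen) : TDScalars.d4 (PresentedGroup.of x) =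
    (TDScalars.genPerm x : Equiv.Perm (TDScalars K)) :=
  PresentedGroup.toGroup.of _

theorem _root_.D4.of_mul_of (x : D4Gen) :
    (PresentedGroup.of x * PresentedGroup.of x : D4) = 1 :=
  PresentedGroup.one_of_mem (x := FreeGroup.of x * FreeGroup.of x) (by cases x <;> simp [D4Rels])

theorem reversed_eq_ddown (ht : tdType β d = .I) : e.reversed β d = e.ddown := by
  simp only [reversed, ht]

namespace IsScalars

-- `↓` is the conjugate of `⇓` by `*`.
theorem hasTransportedScalars_of (h : Φ.IsScalars β e) (hΦ : Φ.IsSharp) (x : D4Gen) :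
    Φ.HasTransportedScalars β e (PresentedGroup.of x) := by
  rw [HasTransportedScalars, d4_of, TDScalars.d4_of]
  cases x with
  | star => exact ⟨hΦ.star, e.star, h.star, hΦ.normalizedDrinfeld_star e, fun _ => rfl⟩
  | down =>
    refine ⟨hΦ, (e.star.reversed β d).star, h.star.ddown.star, ?_, fun ht => ?_⟩
    · exact (hΦ.star.ddown.normalizedDrinfeld_star _).trans
        ((h.star.normalizedDrinfeld_ddown hΦ.star).trans (hΦ.normalizedDrinfeld_star e))
    · rw [reversed_eq_ddown ht]
      rfl
  | ddown => exact ⟨hΦ.ddown, _, h.ddown, h.normalizedDrinfeld_ddown hΦ, reversed_eq_ddown⟩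

theorem hasTransportedScalars (h : Φ.IsScalars β e) (hΦ : Φ.IsSharp) (g : D4) :
    Φ.HasTransportedScalars β e g := by
  have hstep (x : D4Gen) (y : D4) (hy : Φ.HasTransportedScalars β e y) :
      Φ.HasTransportedScalars β e (PresentedGroup.of x * y) := by
    obtain ⟨hsharp, e₁, he₁, hP₁, hI₁⟩ := hy
    obtain ⟨hsharp', e₂, he₂, hP₂, hI₂⟩ := he₁.hasTransportedScalars_of hsharp x
    rw [HasTransportedScalars, map_mul, map_mul, Equiv.Perm.mul_apply, Equiv.Perm.mul_apply]
    exact ⟨hsharp', e₂, he₂, hP₂.trans hP₁, fun ht => by rw [hI₂ ht, hI₁ ht]⟩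
  have hg : g ∈ Subgroup.closure (Set.range (PresentedGroup.of : D4Gen → D4)) :=
    PresentedGroup.closure_range_of D4Rels ▸ Subgroup.mem_top g
  induction hg using Subgroup.closure_induction_left with
  | one => exact ⟨by simpa using hΦ, e, by simpa using h, by simp, by simp⟩
  | mul_left x hx y _ hy =>
    obtain ⟨x, rfl⟩ := hx
    exact hstep x y hy
  | inv_mul_cancel x hx y _ hy =>
    obtain ⟨x, rfl⟩ := hx
    rw [inv_eq_of_mul_eq_one_left (D4.of_mul_of x)]
    exact hstep x y hy

theorem d4_I (h : Φ.IsScalars β e) (hΦ : Φ.IsSharp) (ht : tdType β d = .I) (g : D4) :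
    (d4 g Φ).IsScalars β (TDScalars.d4 g e) := by
  obtain ⟨-, e₀, h₀, -, hI⟩ := h.hasTransportedScalars hΦ g
  exact hI ht ▸ h₀

theorem normalizedDrinfeld_d4 (h : Φ.IsScalars β e) (hΦ : Φ.IsSharp) {g : D4}
    (h' : (d4 g Φ).IsScalars β e') (hI : tdType β d = .I → d = 1 → e' = TDScalars.d4 g e) :
    (d4 g Φ).normalizedDrinfeld β e' = Φ.normalizedDrinfeld β e := by
  obtain ⟨-, e₀, h₀, hP, hI₀⟩ := h.hasTransportedScalars hΦ g
  rw [← hP]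
  by_cases hc : tdType β d = .I ∧ d = 1
  · rw [hI hc.1 hc.2, hI₀ hc.1]
  · exact h'.normalizedDrinfeld_unique h₀ fun ht hd => hc ⟨ht, hd⟩

end IsScalars

end Dihedral

end TridiagonalSystem

theorem mainTheorem2_general {F V : Type*} [Field F] [AddCommGroup V] [Module F V] {d : ℕ}
    (Φ : TridiagonalSystem F V d) (hΦ : Φ.IsSharp) :
    (∀ i ≤ d, Φ.IsSplitValue i (Φ.zeta i)) ∧ (∃ β : F, Φ.IsBase β) ∧
    ∀ β : F, Φ.IsBase β →
      (∃ e : TDScalars (AlgebraicClosure F), Φ.IsScalars β e) ∧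
      ∀ e : TDScalars (AlgebraicClosure F), Φ.IsScalars β e →
        Φ.normalizedDrinfeld β e =
          (Φ.drinfeld β e.q).comp
            (Polynomial.C (e.u β d) * Polynomial.X + Polynomial.C (e.v β d)) ∧
        (tdType β d = TDType.I → ∀ g : D4,
          (TridiagonalSystem.d4 g Φ).IsScalars β (TDScalars.d4 g e)) ∧
        ∀ (g : D4) (e' : TDScalars (AlgebraicClosure F)),
          (TridiagonalSystem.d4 g Φ).IsScalars β e' →
          (tdType β d = TDType.I → d = 1 → e' = TDScalars.d4 g e) →
          (TridiagonalSystem.d4 g Φ).normalizedDrinfeld β e' = Φ.normalizedDrinfeld β e :=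
  ⟨fun i _ => hΦ.isSplitValue_zeta i, Φ.exists_isBase, fun _ hβ => ⟨hβ.exists_isScalars,
    fun _ he => ⟨he.normalizedDrinfeld_eq_comp, he.d4_I hΦ,
      fun _ _ he' hI => he.normalizedDrinfeld_d4 hΦ he' hI⟩⟩⟩

theorem mainTheorem2 {F V : Type*} [Field F] [AddCommGroup V] [Module F V]
    [FiniteDimensional F V] [Nontrivial V] {d : ℕ}
    (Φ : TridiagonalSystem F V d) (hΦ : Φ.IsSharp) :
    -- the split sequence and the base are well defined
    (∀ i ≤ d, Φ.IsSplitValue i (Φ.zeta i)) ∧ (∃ β : F, Φ.IsBase β) ∧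
    ∀ β : F, Φ.IsBase β →
      -- the scalars that enter the normalized polynomial exist
      (∃ e : TDScalars (AlgebraicClosure F), Φ.IsScalars β e) ∧
      ∀ e : TDScalars (AlgebraicClosure F), Φ.IsScalars β e →
        -- the relation between the normalized polynomial and the Drinfel'd polynomial
        Φ.normalizedDrinfeld β e =
          (Φ.drinfeld β e.q).comp
            (Polynomial.C (e.u β d) * Polynomial.X + Polynomial.C (e.v β d)) ∧
        -- for type I, transported scalars are scalars for the relative
        (tdType β d = TDType.I → ∀ g : D4,
          (TridiagonalSystem.d4 g Φ).IsScalars β (TDScalars.d4 g e)) ∧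
        -- invariance; for type I and diameter 1 the scalars of the relative are the
        -- transported ones, in all other cases they are arbitrary
        ∀ (g : D4) (e' : TDScalars (AlgebraicClosure F)),
          (TridiagonalSystem.d4 g Φ).IsScalars β e' →
          (tdType β d = TDType.I → d = 1 → e' = TDScalars.d4 g e) →
          (TridiagonalSystem.d4 g Φ).normalizedDrinfeld β e' = Φ.normalizedDrinfeld β e :=
  mainTheorem2_general Φ hΦ
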